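/- Let $k$ be an algebraically closed field whose cardinality is strictly greater than that of the continuum. Varieties over $k$ are irreducible algebraic varieties in the sense of Serre's FAC: irreducible topological spaces $X$ with a sheaf of $k$-valued functions (the regular functions) that admit a finite open cover by subsets isomorphic to locally closed subsets of affine spaces over $k$, and whose diagonal is closed in the product variety $X\times X$. A variety is normal if all its local rings are integrally closed domains. A partial function $g\colon X\dashrightarrow k$ with domain of definition $\operatorname{dom} g\subseteq X$ is called a rational function on the variety $X$ if $\operatorname{dom} g$ is a dense Zariski open subset of $X$ and $g|_{\operatorname{dom} g}\colon \operatorname{dom} g\to k$ is a morphism of varieties to the affine line $k=k^1$ (that is, $g$ is regular on all of $\operatorname{dom} g$). Let $X$ be a normal variety over $k$ and let $f\colon X\times k\dashrightarrow k$ be a partial function whose domain of definition $\operatorname{dom} f$ is a nonempty Zariski open subset of the product variety $X\times k$. For $a\in X$ let $f_a\colon k\dashrightarrow k$ be the partial function $b\mapsto f(a,b)$ with domain $\{b\in k : (a,b)\in\operatorname{dom} f\}$, and for $b\in k$ let $f^b\colon X\dashrightarrow k$ be the partial function $a\mapsto f(a,b)$ with domain $\{a\in X : (a,b)\in\operatorname{dom}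 f\}$. If $f_a$ is a rational function on $k$ and $f^b$ is a rational function on $X$ for every $(a,b)\in\operatorname{dom} f$, then $f$ is a rational function on $X\times k$. -/

import Mathlib

open Filter Topology

/-- A set `X` with a topology and a subsheaf of `k`-algebras of the sheaf of germs of `k`-valued
functions on `X`. The stalk at `x` is a subring, containing the constants, of the ring of all germs at `x` of
functions `X → k`, and the union of the stalks is open in the étalé space. -/
structure FunctionSheaf (k : Type*) [Field k] (X : Type*) extends TopologicalSpace X where
  stalk (x : X) : Subring (Germ (@nhds X toTopologicalSpace x) k)
  const_mem_stalk (c : k) (x : X) :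
    ((fun _ => c : X → k) : Germ (@nhds X toTopologicalSpace x) k) ∈ stalk x
  eventually_mem_stalk (f : X → k) (x : X)
      (hf : (f : Germ (@nhds X toTopologicalSpace x) k) ∈ stalk x) :
    ∀ᶠ y in @nhds X toTopologicalSpace x, (f : Germ (@nhds X toTopologicalSpace y) k) ∈ stalk y

namespace FunctionSheaf

variable {k : Type*} [Field k] {X Y : Type*}

/-- The function `f` is regular at `x`. Only the values of `f` near `x` matter. -/
def RegularAt (S : FunctionSheaf k X) (f : X → k) (x : X) : Prop :=
  (f : Germ (@nhds X S.toTopologicalSpace x) k) ∈ S.stalk x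

/-- Morphisms: continuous maps that pull regular functions back to regular functions. -/
def IsMorphism (S : FunctionSheaf k X) (T : FunctionSheaf k Y) (φ : X → Y) : Prop :=
  @Continuous X Y S.toTopologicalSpace T.toTopologicalSpace φ ∧
    ∀ (x : X) (g : Y → k), T.RegularAt g (φ x) → S.RegularAt (g ∘ φ) x

/-- The structure induced on a subset `A`: the subspace topology, and germs of restrictions to `A`
of regular functions. -/
def restrict (S : FunctionSheaf k X) (A : Set X) : FunctionSheaf k A where
  toTopologicalSpace := S.toTopologicalSpace.induced Subtype.val
  stalk x :=
    { carrier := {γ | ∃ F : X → k, S.RegularAt F x ∧ γ = ((fun y : A => F y : A → k) : Germ _ k)}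
      mul_mem' := by
        rintro _ _ ⟨F, hF, rfl⟩ ⟨G, hG, rfl⟩
        exact ⟨F * G, (S.stalk x).mul_mem hF hG, rfl⟩
      add_mem' := by
        rintro _ _ ⟨F, hF, rfl⟩ ⟨G, hG, rfl⟩
        exact ⟨F + G, (S.stalk x).add_mem hF hG, rfl⟩
      one_mem' := ⟨1, (S.stalk x).one_mem, rfl⟩
      zero_mem' := ⟨0, (S.stalk x).zero_mem, rfl⟩
      neg_mem' := by
        rintro _ ⟨F, hF, rfl⟩
        exact ⟨-F, (S.stalk x).neg_mem hF, rfl⟩ }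
  const_mem_stalk c x := ⟨fun _ => c, S.const_mem_stalk c x, rfl⟩
  eventually_mem_stalk f x := by
    let := S.toTopologicalSpace
    rintro ⟨F, hF, hfF⟩
    have h1 : ∀ᶠ y in 𝓝 x, f y = F y := Germ.coe_eq.1 hfF
    have h2 : ∀ᶠ y : A in 𝓝 x, S.RegularAt F y :=
      continuous_subtype_val.continuousAt.eventually (S.eventually_mem_stalk F x hF)
    filter_upwards [h1.eventually_nhds, h2] with y hy1 hy2
    exact ⟨F, hy2, Germ.coe_eq.2 hy1⟩

/-- Germs along `l` of quotients `n / d` of functions of an algebra `A` with `d x ≠ 0`. -/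
def fractions (A : Subalgebra k (X → k)) (x : X) (l : Filter X)
    (hl : ∀ d ∈ A, d x ≠ 0 → ∀ᶠ y in l, d y ≠ 0) : Subring (Germ l k) where
  carrier := {γ | ∃ n ∈ A, ∃ d ∈ A, d x ≠ 0 ∧ γ = ((fun y => n y / d y : X → k) : Germ l k)}
  mul_mem' := by
    rintro _ _ ⟨n, hn, d, hd, hdx, rfl⟩ ⟨n', hn', d', hd', hdx', rfl⟩
    refine ⟨n * n', A.mul_mem hn hn', d * d', A.mul_mem hd hd', mul_ne_zero hdx hdx', ?_⟩
    refine Germ.coe_eq.2 (Eventually.of_forall fun y => ?_)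
    simp [div_mul_div_comm]
  add_mem' := by
    rintro _ _ ⟨n, hn, d, hd, hdx, rfl⟩ ⟨n', hn', d', hd', hdx', rfl⟩
    refine ⟨n * d' + d * n', A.add_mem (A.mul_mem hn hd') (A.mul_mem hd hn'), d * d',
      A.mul_mem hd hd', mul_ne_zero hdx hdx', ?_⟩
    refine Germ.coe_eq.2 ?_
    filter_upwards [hl d hd hdx, hl d' hd' hdx'] with y hy hy'
    simp [div_add_div _ _ hy hy']
  one_mem' := by
    refine ⟨1, A.one_mem, 1, A.one_mem, one_ne_zero, ?_⟩
    exact Germ.coe_eq.2 (Eventually.of_forall fun y => by simp)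
  zero_mem' := by
    refine ⟨0, A.zero_mem, 1, A.one_mem, one_ne_zero, ?_⟩
    exact Germ.coe_eq.2 (Eventually.of_forall fun y => by simp)
  neg_mem' := by
    rintro _ ⟨n, hn, d, hd, hdx, rfl⟩
    refine ⟨-n, A.neg_mem hn, d, hd, hdx, ?_⟩
    exact Germ.coe_eq.2 (Eventually.of_forall fun y => by simp [neg_div])

theorem const_mem_fractions (A : Subalgebra k (X → k)) (x : X) (l : Filter X)
    (hl : ∀ d ∈ A, d x ≠ 0 → ∀ᶠ y in l, d y ≠ 0) (c : k) :
    ((fun _ => c : X → k) : Germ l k) ∈ fractions A x l hl := by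
  refine ⟨fun _ => c, A.algebraMap_mem c, 1, A.one_mem, one_ne_zero, ?_⟩
  exact Germ.coe_eq.2 (Eventually.of_forall fun y => by simp)

/-- The topology on `X` whose basic open sets are the sets `{d ≠ 0}` with `d ∈ A`. -/
@[reducible] def algebraTopology (A : Subalgebra k (X → k)) : TopologicalSpace X :=
  TopologicalSpace.generateFrom {V | ∃ d ∈ A, V = {x | d x ≠ 0}}

theorem eventually_algebraTopology (A : Subalgebra k (X → k)) (x : X) (d : X → k) (hd : d ∈ A)
    (hdx : d x ≠ 0) : ∀ᶠ y in @nhds X (algebraTopology A) x, d y ≠ 0 := by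
  let := algebraTopology A
  exact IsOpen.mem_nhds (TopologicalSpace.isOpen_generateFrom_of_mem ⟨d, hd, rfl⟩) hdx

/-- The structure on `X` given by an algebra `A` of functions: its topology is `algebraTopology A`,
and the regular functions are locally quotients of elements of `A`. -/
def ofAlgebra (A : Subalgebra k (X → k)) : FunctionSheaf k X where
  toTopologicalSpace := algebraTopology A
  stalk x := fractions A x (@nhds X (algebraTopology A) x) (eventually_algebraTopology A x)
  const_mem_stalk c x := const_mem_fractions _ _ _ _ c
  eventually_mem_stalk f x := by
    let := algebraTopology A
    rintro ⟨n, hn, d, hd, hdx, hf⟩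
    have h1 : ∀ᶠ y in 𝓝 x, f y = n y / d y := Germ.coe_eq.1 hf
    filter_upwards [h1.eventually_nhds, eventually_algebraTopology A x d hd hdx] with y hy1 hy2
    exact ⟨n, hn, d, hd, hy2, Germ.coe_eq.2 hy1⟩

/-- Affine space `k ^ n` with its Zariski topology and its sheaf of regular functions, both
defined by the algebra of polynomial functions. -/
noncomputable def affineSpace (k : Type*) [Field k] (n : ℕ) : FunctionSheaf k (Fin n → k) :=
  ofAlgebra (MvPolynomial.aeval fun (i : Fin n) (x : Fin n → k) => x i).range

/-- The affine line `k`. -/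
noncomputable def affineLine (k : Type*) [Field k] : FunctionSheaf k k :=
  ofAlgebra (Polynomial.aeval (id : k → k)).range

/-- The algebra of functions `(x, y) ↦ ∑ gᵢ x * hᵢ y` (finite sums), where the `gᵢ` are regular at
all points of `V` and the `hᵢ` are regular at all points of `W`. -/
def tensorOn (S : FunctionSheaf k X) (T : FunctionSheaf k Y) (V : Set X) (W : Set Y) :
    Subalgebra k (X × Y → k) :=
  Algebra.adjoin k
    ({F | ∃ g : X → k, (∀ x ∈ V, S.RegularAt g x) ∧ F = g ∘ Prod.fst} ∪
      {F | ∃ h : Y → k, (∀ y ∈ W, T.RegularAt h y) ∧ F = h ∘ Prod.snd})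

theorem tensorOn_anti (S : FunctionSheaf k X) (T : FunctionSheaf k Y) {V V' : Set X} {W W' : Set Y}
    (hV : V' ⊆ V) (hW : W' ⊆ W) : S.tensorOn T V W ≤ S.tensorOn T V' W' := by
  refine Algebra.adjoin_mono (Set.union_subset_union ?_ ?_)
  · rintro _ ⟨g, hg, rfl⟩
    exact ⟨g, fun x hx => hg x (hV hx), rfl⟩
  · rintro _ ⟨g, hg, rfl⟩
    exact ⟨g, fun x hx => hg x (hW hx), rfl⟩

theorem exists_mem_tensorOn (S : FunctionSheaf k X) (T : FunctionSheaf k Y) (p : X × Y)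
    {F : X × Y → k} (hF : F ∈ S.tensorOn T {p.1} {p.2}) :
    ∃ V W, IsOpen[S.toTopologicalSpace] V ∧ IsOpen[T.toTopologicalSpace] W ∧ p.1 ∈ V ∧ p.2 ∈ W ∧
      F ∈ S.tensorOn T V W := by
  let := S.toTopologicalSpace
  let := T.toTopologicalSpace
  induction hF using Algebra.adjoin_induction with
  | mem F hF =>
    rcases hF with ⟨g, hg, rfl⟩ | ⟨g, hg, rfl⟩
    · obtain ⟨V, hV, hVo, hpV⟩ := eventually_nhds_iff.1 (S.eventually_mem_stalk g p.1 (hg _ rfl))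
      exact ⟨V, Set.univ, hVo, isOpen_univ, hpV, trivial,
        Algebra.subset_adjoin (Or.inl ⟨g, hV, rfl⟩)⟩
    · obtain ⟨W, hW, hWo, hpW⟩ := eventually_nhds_iff.1 (T.eventually_mem_stalk g p.2 (hg _ rfl))
      exact ⟨Set.univ, W, isOpen_univ, hWo, trivial, hpW,
        Algebra.subset_adjoin (Or.inr ⟨g, hW, rfl⟩)⟩
  | algebraMap c =>
    exact ⟨Set.univ, Set.univ, isOpen_univ, isOpen_univ, trivial, trivial,
      Subalgebra.algebraMap_mem _ c⟩
  | add F G _ _ hF hG =>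
    obtain ⟨V, W, hV, hW, hpV, hpW, h⟩ := hF
    obtain ⟨V', W', hV', hW', hpV', hpW', h'⟩ := hG
    exact ⟨V ∩ V', W ∩ W', hV.inter hV', hW.inter hW', ⟨hpV, hpV'⟩, ⟨hpW, hpW'⟩,
      Subalgebra.add_mem _
        (tensorOn_anti S T Set.inter_subset_left Set.inter_subset_left h)
        (tensorOn_anti S T Set.inter_subset_right Set.inter_subset_right h')⟩
  | mul F G _ _ hF hG =>
    obtain ⟨V, W, hV, hW, hpV, hpW, h⟩ := hF
    obtain ⟨V', W', hV', hW', hpV', hpW', h'⟩ := hG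
    exact ⟨V ∩ V', W ∩ W', hV.inter hV', hW.inter hW', ⟨hpV, hpV'⟩, ⟨hpW, hpW'⟩,
      Subalgebra.mul_mem _
        (tensorOn_anti S T Set.inter_subset_left Set.inter_subset_left h)
        (tensorOn_anti S T Set.inter_subset_right Set.inter_subset_right h')⟩

/-- The Zariski topology of the product: the basic open sets are `{p ∈ V × W | F p ≠ 0}` with
`V`, `W` open and `F` a finite sum of products of a regular function on `V` and one on `W`. -/
@[reducible] def prodTopology (S : FunctionSheaf k X) (T : FunctionSheaf k Y) : TopologicalSpace (X × Y) :=
  TopologicalSpace.generateFrom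
    {O | ∃ V W, IsOpen[S.toTopologicalSpace] V ∧ IsOpen[T.toTopologicalSpace] W ∧
      ∃ F ∈ S.tensorOn T V W, O = {p | p.1 ∈ V ∧ p.2 ∈ W ∧ F p ≠ 0}}

theorem eventually_prodTopology (S : FunctionSheaf k X) (T : FunctionSheaf k Y) (p : X × Y)
    {V : Set X} {W : Set Y} {F : X × Y → k} (hV : IsOpen[S.toTopologicalSpace] V)
    (hW : IsOpen[T.toTopologicalSpace] W) (hF : F ∈ S.tensorOn T V W)
    (hpV : p.1 ∈ V) (hpW : p.2 ∈ W) (hp : F p ≠ 0) :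
    ∀ᶠ q in @nhds _ (S.prodTopology T) p, q.1 ∈ V ∧ q.2 ∈ W ∧ F q ≠ 0 := by
  let := S.prodTopology T
  exact IsOpen.mem_nhds (TopologicalSpace.isOpen_generateFrom_of_mem ⟨V, W, hV, hW, F, hF, rfl⟩)
    ⟨hpV, hpW, hp⟩

/-- The product of `S` and `T`: it has the topology `prodTopology`, and its regular functions are
locally quotients of finite sums of products of regular functions of the two variables. -/
def prod (S : FunctionSheaf k X) (T : FunctionSheaf k Y) : FunctionSheaf k (X × Y) where
  toTopologicalSpace := S.prodTopology T
  stalk p := fractions (S.tensorOn T {p.1} {p.2}) p (@nhds _ (S.prodTopology T) p) (by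
    intro d hd hdp
    obtain ⟨V, W, hV, hW, hpV, hpW, h⟩ := exists_mem_tensorOn S T p hd
    filter_upwards [eventually_prodTopology S T p hV hW h hpV hpW hdp] with q hq using hq.2.2)
  const_mem_stalk c x := const_mem_fractions _ _ _ _ c
  eventually_mem_stalk f p := by
    let := S.prodTopology T
    rintro ⟨n, hn, d, hd, hdp, hf⟩
    have h1 : ∀ᶠ q in 𝓝 p, f q = n q / d q := Germ.coe_eq.1 hf
    obtain ⟨V, W, hV, hW, hpV, hpW, h⟩ := exists_mem_tensorOn S T p hd
    obtain ⟨V', W', hV', hW', hpV', hpW', h'⟩ := exists_mem_tensorOn S T p hn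
    filter_upwards [h1.eventually_nhds, eventually_prodTopology S T p hV hW h hpV hpW hdp,
      eventually_prodTopology S T p hV' hW' (Subalgebra.one_mem _) hpV' hpW' one_ne_zero]
      with q hq hq1 hq2
    exact ⟨n, tensorOn_anti S T (Set.singleton_subset_iff.2 hq2.1)
        (Set.singleton_subset_iff.2 hq2.2.1) h', d,
      tensorOn_anti S T (Set.singleton_subset_iff.2 hq1.1) (Set.singleton_subset_iff.2 hq1.2.1) h,
      hq1.2.2, Germ.coe_eq.2 hq⟩

/-- (Irreducible) algebraic varieties in the sense of Serre's FAC: `X` has a finite open cover by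
subsets isomorphic to locally closed subsets of affine spaces, the diagonal is closed in
`X × X`, and `X` is irreducible. -/
structure IsVariety (S : FunctionSheaf k X) : Prop where
  exists_charts : ∃ (m : ℕ) (V : Fin m → Set X),
    (∀ i, IsOpen[S.toTopologicalSpace] (V i)) ∧ (⋃ i, V i) = Set.univ ∧
    ∀ i, ∃ (n : ℕ) (U : Set (Fin n → k)),
      @IsLocallyClosed _ (affineSpace k n).toTopologicalSpace U ∧
      ∃ e : V i ≃ U, IsMorphism (S.restrict (V i)) ((affineSpace k n).restrict U) e ∧
        IsMorphism ((affineSpace k n).restrict U) (S.restrict (V i)) e.symm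
  isClosed_diagonal : IsClosed[(S.prod S).toTopologicalSpace] (Set.diagonal X)
  irreducible : @IrreducibleSpace X S.toTopologicalSpace

/-- Normality: every local ring is an integrally closed domain. -/
def IsNormal (S : FunctionSheaf k X) : Prop :=
  ∀ x, IsDomain (S.stalk x) ∧ IsIntegrallyClosed (S.stalk x)

/-- A partial function is a rational map if its domain is a dense open set on which it is a
morphism. -/
def IsRationalMap (S : FunctionSheaf k X) (T : FunctionSheaf k Y) (f : X →. Y) : Prop :=
  IsOpen[S.toTopologicalSpace] f.Dom ∧ @Dense X S.toTopologicalSpace f.Dom ∧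
    IsMorphism (S.restrict f.Dom) T f.asSubtype

/-- Rational functions are rational maps to the affine line. -/
def IsRationalFunction (S : FunctionSheaf k X) (f : X →. k) : Prop :=
  IsRationalMap S (affineLine k) f

end FunctionSheaf

/-- The slice `f_a : b ↦ f (a, b)`, defined where `(a, b) ∈ dom f`. -/
def PFun.sliceFst {A B C : Type*} (f : A × B →. C) (a : A) : B →. C := fun b => f (a, b)

/-- The slice `f^b : a ↦ f (a, b)`, defined where `(a, b) ∈ dom f`. -/
def PFun.sliceSnd {A B C : Type*} (f : A × B →. C) (b : B) : A →. C := fun a => f (a, b)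

/-!
On an affine chart of `X` with coordinate ring `A`, the function `f` is regular in each variable
separately. For each `b` we have `f (z, b) = n_b z / d_b z` with `n_b, d_b ∈ A`. Suppose that, for
every `N`, the linear system `d_b * P(b) = n_b * Q(b)` in the coefficients of two polynomials
`P, Q ∈ A[X]` of degree less than `N` had a nonvanishing maximal minor. As `k` is uncountable, there
would be a point `z` at which none of these countably many minors vanishes, and `f (z, ·)` would not
be a quotient of two polynomials. So some system has a nontrivial solution, and `f = P / Q`.

The ring `A[X]` is Noetherian and integrally closed, so if `P / Q` is not regular at a point `p`,
then some multiple `h * P / Q = u / r` has its poles along a prime divisor through `p`: `r` vanishes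
there, while `u` does not vanish identically. As `f` takes a finite value at every point of the
divisor near `p`, the identity `r * h * f = u` forces `u` to vanish there, a contradiction.
-/

section Points

variable {k : Type*} [Field k] [IsAlgClosed k]

theorem algebraMap_bijective_of_rank_le_aleph0 [Uncountable k] {L : Type*} [Field L] [Algebra k L]
    (h : Module.rank k L ≤ Cardinal.aleph0) : Function.Bijective (algebraMap k L) := by
  have : Algebra.IsAlgebraic k L := by
    refine ⟨fun x => ?_⟩
    by_contra hx
    have hx : Transcendental k x := hx
    have hle := hx.linearIndependent_sub_inv.cardinal_lift_le_rank.trans (Cardinal.lift_le.2 h)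
    rw [Cardinal.lift_aleph0, Cardinal.lift_le_aleph0] at hle
    exact not_lt.2 hle (Cardinal.aleph0_lt_mk_iff.2 ‹_›)
  exact IsAlgClosed.algebraMap_bijective_of_isIntegral

theorem nonempty_algHom_of_rank_le_aleph0 [Uncountable k] {R : Type*} [CommRing R] [Nontrivial R]
    [Algebra k R] (h : Module.rank k R ≤ Cardinal.aleph0) : Nonempty (R →ₐ[k] k) := by
  obtain ⟨m, _⟩ := Ideal.exists_maximal R
  let := Ideal.Quotient.field m
  have hrank : Module.rank k (R ⧸ m) ≤ Cardinal.aleph0 :=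
    ((Ideal.Quotient.mkₐ k m).toLinearMap.rank_le_of_surjective
      Ideal.Quotient.mk_surjective).trans h
  let e := AlgEquiv.ofBijective (Algebra.ofId k (R ⧸ m))
    (algebraMap_bijective_of_rank_le_aleph0 hrank)
  exact ⟨(e.symm : R ⧸ m →ₐ[k] k).comp (Ideal.Quotient.mkₐ k m)⟩

theorem exists_algHom_forall_ne_zero [Uncountable k] {D ι : Type*} [CommRing D] [IsDomain D]
    [Algebra k D] [Algebra.FiniteType k D] [Countable ι] (g : ι → D) (hg : ∀ i, g i ≠ 0) :
    ∃ φ : D →ₐ[k] k, ∀ i, φ (g i) ≠ 0 := by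
  let ψ : D →ₐ[k] FractionRing D := IsScalarTower.toAlgHom k D (FractionRing D)
  obtain ⟨t, ht⟩ := (‹Algebra.FiniteType k D›).out
  let s : Set (FractionRing D) := ψ '' t ∪ Set.range fun i => (ψ (g i))⁻¹
  have hs : s.Countable := (t.countable_toSet.image ψ).union (Set.countable_range _)
  have hψ (d : D) : ψ d ∈ Algebra.adjoin k s := by
    have hd : ψ d ∈ (Algebra.adjoin k (t : Set D)).map ψ := ⟨d, by simp [ht], rfl⟩
    rw [AlgHom.map_adjoin] at hd
    exact Algebra.adjoin_mono Set.subset_union_left hd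
  obtain ⟨φ⟩ := nonempty_algHom_of_rank_le_aleph0 (k := k) (R := Algebra.adjoin k s)
    ((Algebra.rank_adjoin_le s).trans (max_le hs.le_aleph0 le_rfl))
  refine ⟨φ.comp (ψ.codRestrict _ hψ), fun i => ?_⟩
  have hunit : IsUnit (ψ.codRestrict _ hψ (g i)) :=
    IsUnit.of_mul_eq_one ⟨_, Algebra.subset_adjoin (Or.inr ⟨i, rfl⟩)⟩ <| Subtype.ext <|
      mul_inv_cancel₀ <| (map_ne_zero_iff ψ (IsFractionRing.injective D _)).2 (hg i)
  exact (hunit.map φ).ne_zero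

theorem exists_algHom_le_ker_and_apply_ne_zero {D : Type*} [CommRing D] [Algebra k D]
    [Algebra.FiniteType k D] {I : Ideal D} (hI : I.IsRadical) {s : D} (hs : s ∉ I) :
    ∃ φ : D →ₐ[k] k, I ≤ RingHom.ker φ ∧ φ s ≠ 0 := by
  have := isJacobsonRing_of_finiteType (A := k) (B := D)
  rw [← IsJacobsonRing.out ‹_› hI, Ideal.jacobson, Ideal.mem_sInf] at hs
  push Not at hs
  obtain ⟨m, ⟨hIm, _⟩, hsm⟩ := hs
  let := Ideal.Quotient.field m
  have := finite_of_finite_type_of_isJacobsonRing k (D ⧸ m)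
  let e := AlgEquiv.ofBijective (Algebra.ofId k (D ⧸ m))
    IsAlgClosed.algebraMap_bijective_of_isIntegral
  have hker (d : D) : e.symm (Ideal.Quotient.mk m d) = 0 ↔ d ∈ m := by
    rw [map_eq_zero_iff _ e.symm.injective, Ideal.Quotient.eq_zero_iff_mem]
  exact ⟨(e.symm : D ⧸ m →ₐ[k] k).comp (Ideal.Quotient.mkₐ k m), fun r hr => (hker r).2 (hIm hr),
    fun h => hsm ((hker s).1 h)⟩

end Points

section Minors

open Matrix

variable {E ι : Type*} [Fintype ι] [DecidableEq ι]

theorem exists_ne_zero_forall_dotProduct_eq_zero_of_field {K : Type*} [Field K] (r : E → ι → K)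
    (h : ∀ e : ι → E, (of fun i => r (e i)).det = 0) : ∃ c ≠ 0, ∀ e, r e ⬝ᵥ c = 0 := by
  have hspan : Submodule.span K (Set.range r) < ⊤ := by
    rw [lt_top_iff_ne_top]
    intro htop
    obtain ⟨v, hv, -, hli⟩ := Submodule.exists_fun_fin_finrank_span_eq K (Set.range r)
    have hcard : Fintype.card ι = Module.finrank K (Submodule.span K (Set.range r)) := by
      rw [htop, finrank_top, Module.finrank_fintype_fun_eq_card]
    choose e he using hv
    let σ := Fintype.equivFinOfCardEq hcard
    obtain rfl : (fun i => r (e i)) = v := funext he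
    have hrows : LinearIndependent K (of fun i => r (e (σ i))).row := hli.comp σ σ.injective
    exact ((isUnit_iff_isUnit_det _).1 (linearIndependent_rows_iff_isUnit.1 hrows)).ne_zero (h _)
  obtain ⟨φ, hφ, hle⟩ := Submodule.exists_le_ker_of_lt_top _ hspan
  obtain ⟨c, rfl⟩ := (dotProductEquiv K ι).surjective φ
  refine ⟨c, by rintro rfl; simp at hφ, fun e => ?_⟩
  rw [dotProduct_comm]
  exact hle (Submodule.subset_span ⟨e, rfl⟩)

theorem exists_ne_zero_forall_dotProduct_eq_zero {A : Type*} [CommRing A] [IsDomain A]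
    (r : E → ι → A) (h : ∀ e : ι → E, (of fun i => r (e i)).det = 0) :
    ∃ c ≠ 0, ∀ e, r e ⬝ᵥ c = 0 := by
  let φ := algebraMap A (FractionRing A)
  have hφ : Function.Injective φ := IsFractionRing.injective A _
  obtain ⟨c, hc, hrc⟩ := exists_ne_zero_forall_dotProduct_eq_zero_of_field (fun e => φ ∘ r e)
    fun e => by rw [show of (fun i => φ ∘ r (e i)) = (of fun i => r (e i)).map φ from rfl,
      ← RingHom.mapMatrix_apply, ← RingHom.map_det, h e, map_zero]
  obtain ⟨b, hb⟩ := IsLocalization.exist_integer_multiples_of_finite (nonZeroDivisors A) c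
  choose c' hc' using hb
  have hbc : φ ∘ c' = (b : A) • c := funext hc'
  refine ⟨c', ?_, fun e => hφ ?_⟩
  · rintro rfl
    refine hc ((smul_eq_zero.1 (hbc.symm.trans ?_)).resolve_left (nonZeroDivisors.coe_ne_zero b))
    ext; simp
  · rw [RingHom.map_dotProduct, hbc, dotProduct_smul, hrc, smul_zero, map_zero]

end Minors

section Interpolation

open Polynomial Matrix

variable {A : Type*} [CommRing A]

/-- The row of the linear system `d * P(β) = n * Q(β)`, whose unknowns are the coefficients of two
polynomials `P` and `Q` of degree less than `N`. -/
def interpolationRow (N : ℕ) (n d β : A) : Fin N ⊕ Fin N → A :=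
  Sum.elim (fun j => d * β ^ (j : ℕ)) fun j => -(n * β ^ (j : ℕ))

theorem interpolationRow_dotProduct [DecidableEq A] {N : ℕ} (n d β : A)
    (c : Fin N ⊕ Fin N → A) :
    interpolationRow N n d β ⬝ᵥ c =
      d * (ofFn N (c ∘ Sum.inl)).eval β - n * (ofFn N (c ∘ Sum.inr)).eval β := by
  simp only [interpolationRow, dotProduct, Fintype.sum_sum_type, Sum.elim_inl, Sum.elim_inr,
    ofFn_eq_sum_monomial, eval_finsetSum, eval_monomial, Finset.mul_sum, sub_eq_add_neg,
    ← Finset.sum_neg_distrib, Function.comp_apply]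
  congr 1 <;> exact Finset.sum_congr rfl fun j _ => by ring

theorem map_comp_interpolationRow {B : Type*} [CommRing B] (φ : A →+* B) (N : ℕ) (n d β : A) :
    φ ∘ interpolationRow N n d β = interpolationRow N (φ n) (φ d) (φ β) := by
  ext (j | j) <;> simp [interpolationRow]

theorem det_interpolationRow_eq_zero [IsDomain A] {N : ℕ} {n d β : Fin N ⊕ Fin N → A} {P Q : A[X]}
    (hP : P.natDegree < N) (hQ : Q.natDegree < N) (hQ0 : Q ≠ 0)
    (h : ∀ i, d i * P.eval (β i) = n i * Q.eval (β i)) :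
    (of fun i => interpolationRow N (n i) (d i) (β i)).det = 0 := by
  classical
  refine exists_mulVec_eq_zero_iff.1 ⟨Sum.elim (toFn N P) (toFn N Q), fun h0 => hQ0 ?_, ?_⟩
  · rw [← ofFn_comp_toFn_eq_id_of_natDegree_lt hQ, show toFn N Q = 0 from congrArg (· ∘ Sum.inr) h0,
      map_zero]
  · ext i
    change interpolationRow N (n i) (d i) (β i) ⬝ᵥ _ = 0
    rw [interpolationRow_dotProduct, Sum.elim_comp_inl, Sum.elim_comp_inr,
      ofFn_comp_toFn_eq_id_of_natDegree_lt hP, ofFn_comp_toFn_eq_id_of_natDegree_lt hQ, h, sub_self]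

theorem exists_interpolant [IsDomain A] {E : Type*} [Infinite E] {n d β : E → A}
    (hβ : Function.Injective β) (hd : ∀ e, d e ≠ 0) (N : ℕ)
    (h : ∀ e : Fin N ⊕ Fin N → E,
      (of fun i => interpolationRow N (n (e i)) (d (e i)) (β (e i))).det = 0) :
    ∃ P Q : A[X], Q ≠ 0 ∧ ∀ e, d e * P.eval (β e) = n e * Q.eval (β e) := by
  classical
  obtain ⟨c, hc, hrc⟩ := exists_ne_zero_forall_dotProduct_eq_zero
    (fun e => interpolationRow N (n e) (d e) (β e)) h
  have hPQ (e : E) : d e * (ofFn N (c ∘ Sum.inl)).eval (β e) =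
      n e * (ofFn N (c ∘ Sum.inr)).eval (β e) :=
    sub_eq_zero.1 ((interpolationRow_dotProduct _ _ _ c).symm.trans (hrc e))
  refine ⟨_, _, fun hQ => hc ?_, hPQ⟩
  have hP : ofFn N (c ∘ Sum.inl) = 0 := by
    refine eq_zero_of_infinite_isRoot _ ((Set.infinite_range_of_injective hβ).mono ?_)
    rintro _ ⟨e, rfl⟩
    simpa [hQ, hd e] using hPQ e
  have hinl := injective_ofFn N (hP.trans (map_zero _).symm)
  have hinr := injective_ofFn N (hQ.trans (map_zero _).symm)
  exact funext (Sum.rec (congrFun hinl) (congrFun hinr))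

end Interpolation

section Denominators

variable {B : Type*} [CommRing B] [IsNoetherianRing B]

theorem exists_isPrime_colon_mul_le {I m : Ideal B} [m.IsPrime] {P : B} (hm : I.colon {P} ≤ m) :
    ∃ h, (I.colon {h * P}).IsPrime ∧ I.colon {h * P} ≤ m := by
  obtain ⟨J, hJ, hJm⟩ := Ideal.exists_minimalPrimes_le hm
  have hone : (I.colon {P}).colon {1} = I.colon {P} := by
    ext; simp [Submodule.mem_colon_singleton]
  rw [← hone] at hJ
  obtain ⟨h, hh⟩ := Submodule.exists_eq_colon_of_mem_minimalPrimes hJ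
  have hJh : J = I.colon {h * P} := by
    rw [hh]; ext; simp [Submodule.mem_colon_singleton, mul_assoc]
  exact ⟨h, hJh ▸ hJ.1.1, hJh ▸ hJm⟩

theorem exists_mul_eq_mul_notMem_colon [IsDomain B] [IsIntegrallyClosed B] {P Q : B} (hQ : Q ≠ 0)
    (htop : (Ideal.span {Q}).colon {P} ≠ ⊤) :
    ∃ r ∈ (Ideal.span {Q}).colon {P}, ∃ u ∉ (Ideal.span {Q}).colon {P}, r * P = u * Q := by
  set J := (Ideal.span {Q}).colon {P} with hJ
  have hmem (r : B) : r ∈ J ↔ ∃ u, u * Q = r * P := by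
    rw [hJ, Submodule.mem_colon_singleton, smul_eq_mul, Ideal.mem_span_singleton']
  -- Otherwise `J * (P / Q) ⊆ J`, so `P / Q` is integral over `B` and thus lies in `B`.
  by_contra! hcon
  let φ := algebraMap B (FractionRing B)
  have hφ : Function.Injective φ := IsFractionRing.injective B _
  have hφQ : φ Q ≠ 0 := (map_ne_zero_iff φ hφ).2 hQ
  let N : Submodule B (FractionRing B) :=
    Submodule.map (Algebra.linearMap B (FractionRing B)) J
  have hint : IsIntegral B (φ P / φ Q) := by
    refine isIntegral_of_smul_mem_submodule N ?_ ((IsNoetherian.noetherian J).map _) _ ?_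
    · exact fun hN => hφQ <| (Submodule.mem_bot B).1 <| hN ▸
        Submodule.mem_map_of_mem ((hmem Q).2 ⟨P, mul_comm P Q⟩)
    · rintro _ ⟨r, hr, rfl⟩
      obtain ⟨u, hu⟩ := (hmem r).1 hr
      refine ⟨u, by_contra fun huJ => hcon r hr u huJ hu.symm, ?_⟩
      rw [Algebra.linearMap_apply, Algebra.linearMap_apply, smul_eq_mul, div_mul_eq_mul_div,
        eq_div_iff hφQ, ← map_mul, ← map_mul, hu, mul_comm]
  obtain ⟨u, hu⟩ := IsIntegrallyClosed.isIntegral_iff.1 hint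
  rw [eq_div_iff hφQ, ← map_mul] at hu
  exact htop (J.eq_top_iff_one.2 ((hmem 1).2 ⟨u, (hφ hu).trans (one_mul P).symm⟩))

theorem exists_mul_eq_mul_notMem_or_exists_isPrime [IsDomain B] [IsIntegrallyClosed B] {Q : B}
    (hQ : Q ≠ 0) (P : B) (m : Ideal B) [hm : m.IsPrime] : (∃ d ∉ m, ∃ n, d * P = n * Q) ∨
      ∃ J : Ideal B, J.IsPrime ∧ J ≤ m ∧ ∃ r ∈ J, ∃ u ∉ J, ∃ h, r * h * P = u * Q := by
  by_cases hle : (Ideal.span {Q}).colon {P} ≤ m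
  · obtain ⟨h, hJ, hJm⟩ := exists_isPrime_colon_mul_le hle
    obtain ⟨r, hr, u, hu, hru⟩ :=
      exists_mul_eq_mul_notMem_colon hQ (ne_top_of_le_ne_top hm.ne_top hJm)
    exact Or.inr ⟨_, hJ, hJm, r, hr, u, hu, h, (mul_assoc r h P).trans hru⟩
  · obtain ⟨d, hd, hdm⟩ := SetLike.not_le_iff_exists.1 hle
    obtain ⟨n, hn⟩ := Ideal.mem_span_singleton'.1 (Submodule.mem_colon_singleton.1 hd)
    exact Or.inl ⟨d, hdm, n, hn.symm⟩

end Denominators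

namespace FunctionSheaf

section Regular

variable {k : Type*} [Field k] {X Y : Type*} {S : FunctionSheaf k X} {x : X} {g g' : X → k}

theorem RegularAt.congr (hg : S.RegularAt g x)
    (h : ∀ᶠ y in @nhds X S.toTopologicalSpace x, g' y = g y) : S.RegularAt g' x := by
  have hgg' : (g' : Germ (@nhds X S.toTopologicalSpace x) k) = g := Germ.coe_eq.2 h
  unfold RegularAt
  rwa [hgg']

/-- The algebra of all functions on `X` that are regular at `x`. -/
def regularSubalgebra (S : FunctionSheaf k X) (x : X) : Subalgebra k (X → k) where
  carrier := {g | S.RegularAt g x}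
  mul_mem' hg hg' := (S.stalk x).mul_mem hg hg'
  add_mem' hg hg' := (S.stalk x).add_mem hg hg'
  algebraMap_mem' c := S.const_mem_stalk c x

/-- A regular function that does not vanish at a point is invertible near this point. -/
structure IsLocallyRinged (S : FunctionSheaf k X) : Prop where
  eventually_ne_zero {g : X → k} {x : X} (hg : S.RegularAt g x) (hgx : g x ≠ 0) :
    ∀ᶠ y in @nhds X S.toTopologicalSpace x, g y ≠ 0
  inv {g : X → k} {x : X} (hg : S.RegularAt g x) (hgx : g x ≠ 0) : S.RegularAt g⁻¹ x

theorem IsLocallyRinged.regularAt_of_mul_eq (hS : S.IsLocallyRinged) {n d : X → k}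
    (hn : S.RegularAt n x) (hd : S.RegularAt d x) (hdx : d x ≠ 0)
    (h : ∀ᶠ y in @nhds X S.toTopologicalSpace x, d y * g y = n y) : S.RegularAt g x := by
  refine RegularAt.congr ((S.stalk x).mul_mem hn (hS.inv hd hdx)) ?_
  filter_upwards [h, hS.eventually_ne_zero hd hdx] with y hy hdy
  rw [Pi.inv_apply, ← hy, mul_right_comm, mul_inv_cancel₀ hdy, one_mul]

theorem isLocallyRinged_of_stalk_eq_fractions (B : X → Subalgebra k (X → k))
    (h : ∀ x, ∃ hl, S.stalk x = fractions (B x) x (@nhds X S.toTopologicalSpace x) hl) :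
    S.IsLocallyRinged := by
  let := S.toTopologicalSpace
  have key {g : X → k} {x : X} (hg : S.RegularAt g x) (hgx : g x ≠ 0) :
      (∀ᶠ y in 𝓝 x, g y ≠ 0) ∧ S.RegularAt g⁻¹ x := by
    obtain ⟨hl, hx⟩ := h x
    unfold RegularAt at hg ⊢
    rw [hx] at hg ⊢
    obtain ⟨n, hn, d, hd, hdx, hgnd⟩ := hg
    have hgnd : ∀ᶠ y in 𝓝 x, g y = n y / d y := Germ.coe_eq.1 hgnd
    have hnx : n x ≠ 0 := fun hnx => hgx (by rw [hgnd.self_of_nhds, hnx, zero_div])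
    refine ⟨?_, d, hd, n, hn, hnx, Germ.coe_eq.2 ?_⟩
    · filter_upwards [hgnd, hl n hn hnx, hl d hd hdx] with y hy hny hdy
      exact hy ▸ div_ne_zero hny hdy
    · filter_upwards [hgnd] with y hy
      rw [Pi.inv_apply, hy, inv_div]
  exact ⟨fun hg hgx => (key hg hgx).1, fun hg hgx => (key hg hgx).2⟩

theorem isLocallyRinged_ofAlgebra (A : Subalgebra k (X → k)) : (ofAlgebra A).IsLocallyRinged :=
  isLocallyRinged_of_stalk_eq_fractions (fun _ => A) fun x =>
    ⟨eventually_algebraTopology A x, rfl⟩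

theorem isLocallyRinged_prod (S : FunctionSheaf k X) (T : FunctionSheaf k Y) :
    (S.prod T).IsLocallyRinged := by
  refine isLocallyRinged_of_stalk_eq_fractions (fun p => S.tensorOn T {p.1} {p.2}) fun p =>
    ⟨fun d hd hdp => ?_, rfl⟩
  obtain ⟨V, W, hV, hW, hpV, hpW, hd⟩ := exists_mem_tensorOn S T p hd
  exact (eventually_prodTopology S T p hV hW hd hpV hpW hdp).mono fun q hq => hq.2.2

end Regular

section OfAlgebra

variable {k : Type*} [Field k] {Y : Type*} {R : Subalgebra k (Y → k)}

theorem isTopologicalBasis_algebraTopology (R : Subalgebra k (Y → k)) :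
    @TopologicalSpace.IsTopologicalBasis Y (algebraTopology R)
      {V | ∃ d ∈ R, V = {x | d x ≠ 0}} := by
  let := algebraTopology R
  refine ⟨?_, Set.eq_univ_of_forall fun y => ?_, rfl⟩
  · rintro _ ⟨d, hd, rfl⟩ _ ⟨d', hd', rfl⟩ y ⟨hy, hy'⟩
    exact ⟨_, ⟨d * d', R.mul_mem hd hd', rfl⟩, mul_ne_zero hy hy', fun z hz =>
      ⟨left_ne_zero_of_mul hz, right_ne_zero_of_mul hz⟩⟩
  · exact ⟨_, ⟨1, R.one_mem, rfl⟩, one_ne_zero⟩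

theorem isOpen_ne_zero {d : Y → k} (hd : d ∈ R) : IsOpen[algebraTopology R] {y | d y ≠ 0} :=
  TopologicalSpace.isOpen_generateFrom_of_mem ⟨d, hd, rfl⟩

theorem exists_ne_zero_subset_of_isOpen {O : Set Y} (hO : IsOpen[algebraTopology R] O) {y : Y}
    (hy : y ∈ O) : ∃ d ∈ R, d y ≠ 0 ∧ {z | d z ≠ 0} ⊆ O := by
  let := algebraTopology R
  obtain ⟨_, ⟨d, hd, rfl⟩, hdy, hdO⟩ :=
    (isTopologicalBasis_algebraTopology R).exists_subset_of_mem_open hy hO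
  exact ⟨d, hd, hdy, hdO⟩

theorem regularAt_of_mem {g : Y → k} (hg : g ∈ R) (y : Y) : (ofAlgebra R).RegularAt g y :=
  ⟨g, hg, 1, R.one_mem, one_ne_zero, Germ.coe_eq.2 (Eventually.of_forall fun z => by simp)⟩

theorem regularAt_ofAlgebra_iff {g : Y → k} {y : Y} :
    (ofAlgebra R).RegularAt g y ↔ ∃ n ∈ R, ∃ d ∈ R, d y ≠ 0 ∧ ∀ z, d z * g z = n z := by
  let := algebraTopology R
  constructor
  · rintro ⟨n, hn, d, hd, hdy, h⟩
    obtain ⟨O, hO, hOo, hyO⟩ := eventually_nhds_iff.1 (Germ.coe_eq.1 h)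
    obtain ⟨s, hs, hsy, hsO⟩ := exists_ne_zero_subset_of_isOpen hOo hyO
    refine ⟨n * (s * d), R.mul_mem hn (R.mul_mem hs hd), d * (s * d),
      R.mul_mem hd (R.mul_mem hs hd), mul_ne_zero hdy (mul_ne_zero hsy hdy), fun z => ?_⟩
    simp only [Pi.mul_apply]
    by_cases hz : s z * d z = 0
    · simp [hz]
    · have hdz := right_ne_zero_of_mul hz
      rw [hO z (hsO (left_ne_zero_of_mul hz))]
      field_simp
  · rintro ⟨n, hn, d, hd, hdy, h⟩
    exact (isLocallyRinged_ofAlgebra R).regularAt_of_mul_eq (regularAt_of_mem hn y)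
      (regularAt_of_mem hd y) hdy (Eventually.of_forall h)

/-- Evaluation at a point of an algebra of functions. -/
def pointEval (R : Subalgebra k (Y → k)) (y : Y) : R →ₐ[k] k :=
  (Pi.evalAlgHom k (fun _ => k) y).comp R.val

@[simp] theorem pointEval_apply (y : Y) (a : R) : pointEval R y a = a.1 y := rfl

theorem isDomain_of_irreducibleSpace (h : @IrreducibleSpace Y (algebraTopology R)) :
    IsDomain R := by
  let := algebraTopology R
  have : Nontrivial R := ⟨0, 1, fun h01 =>
    zero_ne_one (congrFun (congrArg Subtype.val h01) h.toNonempty.some)⟩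
  have : NoZeroDivisors R := ⟨fun {a b} hab => by
    by_contra! hne
    have hsupp (c : R) (hc : c ≠ 0) : {y | c.1 y ≠ 0}.Nonempty :=
      Function.ne_iff.1 fun h0 => hc (Subtype.ext h0)
    obtain ⟨y, ha, hb⟩ := nonempty_preirreducible_inter (isOpen_ne_zero a.2) (isOpen_ne_zero b.2)
      (hsupp a hne.1) (hsupp b hne.2)
    exact mul_ne_zero ha hb (congrFun (congrArg Subtype.val hab) y)⟩
  exact NoZeroDivisors.to_isDomain R

theorem irreducibleSpace_of_isDomain [Nonempty Y] [IsDomain R] :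
    @IrreducibleSpace Y (algebraTopology R) := by
  let := algebraTopology R
  refine { isPreirreducible_univ := ?_, toNonempty := ‹_› }
  rintro O O' hO hO' ⟨y, -, hy⟩ ⟨y', -, hy'⟩
  obtain ⟨d, hd, hdy, hdO⟩ := exists_ne_zero_subset_of_isOpen hO hy
  obtain ⟨d', hd', hdy', hdO'⟩ := exists_ne_zero_subset_of_isOpen hO' hy'
  have hne : (⟨d, hd⟩ * ⟨d', hd'⟩ : R) ≠ 0 := mul_ne_zero
    (fun h => hdy (congrFun (congrArg Subtype.val h) y))
    (fun h => hdy' (congrFun (congrArg Subtype.val h) y'))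
  obtain ⟨z, hz⟩ := Function.ne_iff.1 fun h0 => hne (Subtype.ext h0)
  exact ⟨z, trivial, hdO (left_ne_zero_of_mul hz), hdO' (right_ne_zero_of_mul hz)⟩

end OfAlgebra

section OpenImmersions

variable {k : Type*} [Field k] {X Y Z : Type*} {S : FunctionSheaf k X} {T : FunctionSheaf k Y}

/-- Open immersions: isomorphisms onto an open subspace. -/
structure IsOpenImmersion (T : FunctionSheaf k Y) (S : FunctionSheaf k X) (j : Y → X) : Prop where
  isOpenEmbedding : @IsOpenEmbedding Y X T.toTopologicalSpace S.toTopologicalSpace j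
  regularAt_comp_iff {g : X → k} {y : Y} : T.RegularAt (g ∘ j) y ↔ S.RegularAt g (j y)

namespace IsOpenImmersion

variable {j : Y → X}

theorem injective (hj : T.IsOpenImmersion S j) : Function.Injective j :=
  let := S.toTopologicalSpace
  let := T.toTopologicalSpace
  hj.isOpenEmbedding.injective

theorem map_nhds_eq (hj : T.IsOpenImmersion S j) (y : Y) :
    map j (@nhds Y T.toTopologicalSpace y) = @nhds X S.toTopologicalSpace (j y) :=
  let := S.toTopologicalSpace
  let := T.toTopologicalSpace
  hj.isOpenEmbedding.map_nhds_eq y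

theorem isOpen_range (hj : T.IsOpenImmersion S j) : IsOpen[S.toTopologicalSpace] (Set.range j) :=
  let := S.toTopologicalSpace
  let := T.toTopologicalSpace
  hj.isOpenEmbedding.isOpen_range

theorem comp {R : FunctionSheaf k Z} {i : Z → Y} (hj : T.IsOpenImmersion S j)
    (hi : R.IsOpenImmersion T i) : R.IsOpenImmersion S (j ∘ i) where
  isOpenEmbedding :=
    let := S.toTopologicalSpace
    let := T.toTopologicalSpace
    let := R.toTopologicalSpace
    hj.isOpenEmbedding.comp hi.isOpenEmbedding
  regularAt_comp_iff := hi.regularAt_comp_iff.trans hj.regularAt_comp_iff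

theorem regularAt_extend_iff (hj : T.IsOpenImmersion S j) {g : Y → k} {y : Y} :
    S.RegularAt (Function.extend j g 0) (j y) ↔ T.RegularAt g y := by
  rw [← hj.regularAt_comp_iff, Function.extend_comp hj.injective]

theorem irreducibleSpace (hj : T.IsOpenImmersion S j) [hY : Nonempty Y]
    (hX : @IrreducibleSpace X S.toTopologicalSpace) : @IrreducibleSpace Y T.toTopologicalSpace := by
  let := S.toTopologicalSpace
  let := T.toTopologicalSpace
  exact { isPreirreducible_univ := hX.isPreirreducible_univ.preimage hj.isOpenEmbedding
          toNonempty := hY }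

theorem isLocallyRinged_of_surjective {ι : Type*} {Y : ι → Type*} {T : ∀ i, FunctionSheaf k (Y i)}
    {j : ∀ i, Y i → X} (hj : ∀ i, (T i).IsOpenImmersion S (j i))
    (hT : ∀ i, (T i).IsLocallyRinged) (hX : ∀ x, ∃ i y, j i y = x) : S.IsLocallyRinged where
  eventually_ne_zero {g x} hg hgx := by
    obtain ⟨i, y, rfl⟩ := hX x
    rw [← (hj i).map_nhds_eq]
    exact (hT i).eventually_ne_zero ((hj i).regularAt_comp_iff.2 hg) hgx
  inv {g x} hg hgx := by
    obtain ⟨i, y, rfl⟩ := hX x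
    exact (hj i).regularAt_comp_iff.1 ((hT i).inv ((hj i).regularAt_comp_iff.2 hg) hgx)

end IsOpenImmersion

theorem isOpenImmersion_val_restrict {V : Set X} (hV : IsOpen[S.toTopologicalSpace] V) :
    (S.restrict V).IsOpenImmersion S Subtype.val where
  isOpenEmbedding :=
    let := S.toTopologicalSpace
    hV.isOpenEmbedding_subtypeVal
  regularAt_comp_iff {g x} := by
    let := S.toTopologicalSpace
    refine ⟨?_, fun hg => ⟨g, hg, rfl⟩⟩
    rintro ⟨G, hG, hgG⟩
    have hgG : ∀ᶠ y : V in 𝓝 x, g y = G y := Germ.coe_eq.1 hgG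
    refine hG.congr ?_
    rwa [← hV.isOpenEmbedding_subtypeVal.map_nhds_eq]

theorem isOpenImmersion_of_isMorphism (e : Y ≃ X) (he : T.IsMorphism S e)
    (he' : S.IsMorphism T e.symm) : T.IsOpenImmersion S e where
  isOpenEmbedding :=
    let := S.toTopologicalSpace
    let := T.toTopologicalSpace
    (Homeomorph.mk e he.1 he'.1).isOpenEmbedding
  regularAt_comp_iff {g y} := by
    refine ⟨fun hg => ?_, he.2 y g⟩
    have h := he'.2 (e y) (g ∘ e) (by rwa [e.symm_apply_apply])
    rwa [Function.comp_assoc, e.self_comp_symm, Function.comp_id] at h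

/-- Composition with `c`, as a homomorphism of algebras of functions. -/
def precomp (k : Type*) [Field k] (c : Z → Y) : (Y → k) →ₐ[k] (Z → k) :=
  AlgHom.pi fun z => Pi.evalAlgHom k (fun _ => k) (c z)

@[simp] theorem precomp_apply (c : Z → Y) (r : Y → k) : precomp k c r = r ∘ c := rfl

/-- The algebra of the compositions with `c` of the functions in `R`. -/
def pullback (c : Z → Y) (R : Subalgebra k (Y → k)) : Subalgebra k (Z → k) :=
  R.map (precomp k c)

theorem comp_mem_pullback (c : Z → Y) {R : Subalgebra k (Y → k)} {r : Y → k} (hr : r ∈ R) :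
    r ∘ c ∈ pullback c R := ⟨r, hr, rfl⟩

theorem algebraTopology_pullback (c : Z → Y) (R : Subalgebra k (Y → k)) :
    algebraTopology (pullback c R) = (algebraTopology R).induced c := by
  refine (congrArg TopologicalSpace.generateFrom ?_).trans induced_generateFrom_eq.symm
  ext O
  constructor
  · rintro ⟨_, ⟨r, hr, rfl⟩, rfl⟩
    exact ⟨_, ⟨r, hr, rfl⟩, rfl⟩
  · rintro ⟨_, ⟨r, hr, rfl⟩, rfl⟩
    exact ⟨_, comp_mem_pullback c hr, rfl⟩

theorem isOpenImmersion_id_pullback (R : Subalgebra k (Y → k)) (U : Set Y) :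
    (ofAlgebra (pullback (Subtype.val : U → Y) R)).IsOpenImmersion
      ((ofAlgebra R).restrict U) id where
  isOpenEmbedding := by
    change @IsOpenEmbedding U U (algebraTopology _) ((algebraTopology R).induced _) id
    rw [algebraTopology_pullback]
    exact @IsOpenEmbedding.id U (_)
  regularAt_comp_iff {g u} := by
    let := algebraTopology R
    constructor
    · intro hg
      obtain ⟨_, ⟨n, hn, rfl⟩, _, ⟨d, hd, rfl⟩, hdu, h⟩ := regularAt_ofAlgebra_iff.1 hg
      refine RegularAt.congr (g := fun u : U => n u / d u) ⟨fun y => n y / d y,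
        ⟨n, hn, d, hd, hdu, rfl⟩, rfl⟩ ?_
      have hd0 : ∀ᶠ v : U in 𝓝 u, d v ≠ 0 :=
        continuous_subtype_val.continuousAt.eventually (eventually_algebraTopology R _ d hd hdu)
      filter_upwards [hd0] with v hv
      exact (eq_div_iff hv).2 ((mul_comm _ _).trans (h v))
    · rintro ⟨G, hG, hgG⟩
      obtain ⟨n, hn, d, hd, hdu, h⟩ := regularAt_ofAlgebra_iff.1 hG
      refine RegularAt.congr (regularAt_ofAlgebra_iff.2 ⟨_, comp_mem_pullback _ hn, _,
        comp_mem_pullback _ hd, hdu, fun v => h v⟩) ?_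
      have hgG : ∀ᶠ v : U in 𝓝 u, g v = G v := Germ.coe_eq.1 hgG
      change ∀ᶠ v in @nhds U (algebraTopology _) u, g v = G v
      rwa [algebraTopology_pullback]

/-- The algebra of the functions `p / h ^ N` with `p ∈ R` on the principal open set `{h ≠ 0}`. -/
def away (R : Subalgebra k (Y → k)) (h : R) : Subalgebra k ({y // h.1 y ≠ 0} → k) where
  carrier := {a | ∃ N, ∃ p ∈ R, ∀ y, a y * h.1 y ^ N = p y}
  mul_mem' := by
    rintro a b ⟨N, p, hp, ha⟩ ⟨M, q, hq, hb⟩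
    refine ⟨N + M, p * q, R.mul_mem hp hq, fun y => ?_⟩
    rw [Pi.mul_apply, Pi.mul_apply, ← ha, ← hb]
    ring
  add_mem' := by
    rintro a b ⟨N, p, hp, ha⟩ ⟨M, q, hq, hb⟩
    refine ⟨N + M, p * h.1 ^ M + q * h.1 ^ N, R.add_mem (R.mul_mem hp (R.pow_mem h.2 M))
      (R.mul_mem hq (R.pow_mem h.2 N)), fun y => ?_⟩
    simp only [Pi.add_apply, Pi.mul_apply, Pi.pow_apply, ← ha, ← hb]
    ring
  algebraMap_mem' c := ⟨0, _, R.algebraMap_mem c, fun y => by simp⟩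

theorem pullback_le_away (R : Subalgebra k (Y → k)) (h : R) :
    pullback Subtype.val R ≤ away R h := by
  rintro _ ⟨r, hr, rfl⟩
  exact ⟨0, r, hr, fun y => by simp⟩

theorem comp_val_mem_away {R : Subalgebra k (Y → k)} (h : R) {r : Y → k} (hr : r ∈ R) :
    (fun y => r y : {y // h.1 y ≠ 0} → k) ∈ away R h :=
  pullback_le_away R h (comp_mem_pullback _ hr)

theorem inv_mem_away {R : Subalgebra k (Y → k)} (h : R) :
    (fun y => (h.1 y)⁻¹ : {y // h.1 y ≠ 0} → k) ∈ away R h :=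
  ⟨1, 1, R.one_mem, fun y => by simp [inv_mul_cancel₀ y.2]⟩

theorem away_eq_sup (R : Subalgebra k (Y → k)) (h : R) :
    away R h = pullback Subtype.val R ⊔ Algebra.adjoin k {fun y => (h.1 y.1)⁻¹} := by
  refine le_antisymm ?_ (sup_le (pullback_le_away R h)
    (Algebra.adjoin_le (Set.singleton_subset_iff.2 (inv_mem_away h))))
  rintro a ⟨N, p, hp, ha⟩
  have hap : a = p ∘ Subtype.val * (fun y => (h.1 y.1)⁻¹) ^ N := by
    ext y
    rw [Pi.mul_apply, Function.comp_apply, ← ha, Pi.pow_apply, mul_assoc, ← mul_pow,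
      mul_inv_cancel₀ y.2, one_pow, mul_one]
  rw [hap]
  exact mul_mem (SetLike.le_def.1 le_sup_left (comp_mem_pullback _ hp))
    (pow_mem (SetLike.le_def.1 le_sup_right (Algebra.self_mem_adjoin_singleton k _)) N)

theorem isOpenImmersion_val_away (R : Subalgebra k (Y → k)) (h : R) :
    (ofAlgebra (away R h)).IsOpenImmersion (ofAlgebra R) Subtype.val where
  isOpenEmbedding := by
    let := algebraTopology R
    let := algebraTopology (away R h)
    refine .of_continuous_injective_isOpenMap (continuous_generateFrom_iff.2 ?_)
      Subtype.val_injective ((isTopologicalBasis_algebraTopology _).isOpenMap_iff.2 ?_)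
    · rintro _ ⟨d, hd, rfl⟩
      exact isOpen_ne_zero (comp_val_mem_away h hd)
    · rintro _ ⟨a, ⟨N, p, hp, ha⟩, rfl⟩
      have himage : Subtype.val '' {y | a y ≠ 0} = {y | (p * h.1) y ≠ 0} := by
        ext y
        constructor
        · rintro ⟨y, hay, rfl⟩
          exact mul_ne_zero (ha y ▸ mul_ne_zero hay (pow_ne_zero N y.2)) y.2
        · intro hy
          have hpy : p y ≠ 0 := left_ne_zero_of_mul hy
          let y' : {y // h.1 y ≠ 0} := ⟨y, right_ne_zero_of_mul hy⟩
          exact ⟨y', left_ne_zero_of_mul ((ha y').trans_ne hpy), rfl⟩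
      exact himage ▸ isOpen_ne_zero (R.mul_mem hp h.2)
  regularAt_comp_iff {g y} := by
    constructor
    · intro hg
      obtain ⟨n, ⟨N, n', hn', hn⟩, d, ⟨M, d', hd', hd⟩, hdy, hdn⟩ := regularAt_ofAlgebra_iff.1 hg
      refine regularAt_ofAlgebra_iff.2 ⟨h.1 * (n' * h.1 ^ M), R.mul_mem h.2 (R.mul_mem hn'
        (R.pow_mem h.2 M)), h.1 * (d' * h.1 ^ N), R.mul_mem h.2 (R.mul_mem hd'
        (R.pow_mem h.2 N)), ?_, fun z => ?_⟩
      · exact mul_ne_zero y.2 (mul_ne_zero (hd y ▸ mul_ne_zero hdy (pow_ne_zero M y.2))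
          (pow_ne_zero N y.2))
      · by_cases hz : h.1 z = 0
        · simp [hz]
        · have h₁ := hn ⟨z, hz⟩
          have h₂ := hd ⟨z, hz⟩
          have h₃ : d ⟨z, hz⟩ * g z = n ⟨z, hz⟩ := hdn ⟨z, hz⟩
          simp only [Pi.mul_apply, Pi.pow_apply, ← h₁, ← h₂, ← h₃]
          ring
    · intro hg
      obtain ⟨n, hn, d, hd, hdy, hdn⟩ := regularAt_ofAlgebra_iff.1 hg
      exact regularAt_ofAlgebra_iff.2 ⟨_, comp_val_mem_away h hn, _, comp_val_mem_away h hd, hdy,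
        fun z => hdn z⟩

end OpenImmersions

section AffineCharts

universe u

variable {k : Type u} [Field k] {X Y Z : Type*}

/-- The algebra `A` of functions on `Z` is the coordinate ring of an affine algebraic set with
underlying set `Z`: it is finitely generated and its characters are the points of `Z`. -/
structure IsCoordinateRing (A : Subalgebra k (Z → k)) : Prop where
  fg : A.FG
  surjective_pointEval : Function.Surjective (pointEval A)

theorem isCoordinateRing_mvPolynomial (n : ℕ) :
    IsCoordinateRing (MvPolynomial.aeval fun (i : Fin n) (x : Fin n → k) => x i).range where
  fg := by
    rw [← Algebra.adjoin_range_eq_range_aeval]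
    exact Subalgebra.fg_def.2 ⟨_, Set.finite_range _, rfl⟩
  surjective_pointEval φ := by
    refine ⟨fun i => φ (AlgHom.rangeRestrict _ (MvPolynomial.X i)), ?_⟩
    refine (AlgHom.cancel_right (AlgHom.rangeRestrict_surjective _)).1
      (MvPolynomial.algHom_ext fun i => ?_)
    simp

/-- Composition with `c`, as a homomorphism onto the pullback. -/
def pullbackHom (c : Z → Y) (R : Subalgebra k (Y → k)) : R →ₐ[k] pullback c R :=
  AlgHom.codRestrict ((precomp k c).comp R.val) _ fun r => comp_mem_pullback c r.2

theorem pullbackHom_surjective (c : Z → Y) (R : Subalgebra k (Y → k)) :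
    Function.Surjective (pullbackHom c R) := by
  rintro ⟨_, r, hr, rfl⟩
  exact ⟨⟨r, hr⟩, rfl⟩

theorem surjective_pointEval_away {R : Subalgebra k (Y → k)} {h : R}
    (hR : ∀ φ : R →ₐ[k] k, φ h ≠ 0 → φ ∈ Set.range (pointEval R)) :
    Function.Surjective (pointEval (away R h)) := by
  intro φ
  let ρ : R →ₐ[k] away R h :=
    (Subalgebra.inclusion (pullback_le_away R h)).comp (pullbackHom Subtype.val R)
  have hinv : ρ h * ⟨_, inv_mem_away h⟩ = 1 :=
    Subtype.ext <| funext fun y => mul_inv_cancel₀ y.2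
  have hφh : φ (ρ h) ≠ 0 := by
    intro h0
    have h1 := congrArg φ hinv
    rw [map_mul, h0, zero_mul, map_one] at h1
    exact zero_ne_one h1
  obtain ⟨y, hy⟩ := hR (φ.comp ρ) hφh
  have hφ (a : R) : φ (ρ a) = a.1 y := (DFunLike.congr_fun hy a).symm
  have hhy : h.1 y ≠ 0 := hφ h ▸ hφh
  refine ⟨⟨y, hhy⟩, AlgHom.ext fun ⟨a, N, p, hp, ha⟩ => ?_⟩
  have haN : ⟨a, N, p, hp, ha⟩ * ρ h ^ N = ρ ⟨p, hp⟩ := Subtype.ext (funext ha)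
  have hay := congrArg φ haN
  rw [map_mul, map_pow, hφ, hφ] at hay
  exact mul_right_cancel₀ (pow_ne_zero N hhy) ((ha ⟨y, hhy⟩).trans hay.symm)

theorem mem_range_pointEval_pullback {R : Subalgebra k (Y → k)}
    (hR : Function.Surjective (pointEval R)) {U C : Set Y} (hC : IsClosed[algebraTopology R] C)
    (hUC : U ⊆ C) {r : R} (hCU : ∀ y ∈ C, r.1 y ≠ 0 → y ∈ U)
    {φ : pullback (Subtype.val : U → Y) R →ₐ[k] k} (hφr : φ (pullbackHom _ R r) ≠ 0) :
    φ ∈ Set.range (pointEval _) := by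
  obtain ⟨y, hy⟩ := hR (φ.comp (pullbackHom _ R))
  have hφ (a : R) : φ (pullbackHom _ R a) = a.1 y := (DFunLike.congr_fun hy a).symm
  have hyC : y ∈ C := by
    by_contra hyC
    obtain ⟨d, hd, hdy, hdC⟩ := exists_ne_zero_subset_of_isOpen hC.isOpen_compl hyC
    have hd0 : pullbackHom (Subtype.val : U → Y) R ⟨d, hd⟩ = 0 :=
      Subtype.ext <| funext fun z => of_not_not fun hdz => hdC hdz (hUC z.2)
    exact hdy ((hφ ⟨d, hd⟩).symm.trans (by rw [hd0, map_zero]))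
  refine ⟨⟨y, hCU y hyC (hφ r ▸ hφr)⟩, AlgHom.ext fun a => ?_⟩
  obtain ⟨a, rfl⟩ := pullbackHom_surjective _ R a
  exact (hφ a).symm

theorem IsCoordinateRing.away_pullback {R : Subalgebra k (Y → k)} (hR : IsCoordinateRing R)
    {U C : Set Y} (hC : IsClosed[algebraTopology R] C) (hUC : U ⊆ C) {r : R}
    (hCU : ∀ y ∈ C, r.1 y ≠ 0 → y ∈ U) :
    IsCoordinateRing (away _ (pullbackHom (Subtype.val : U → Y) R r)) where
  fg := by
    rw [away_eq_sup]
    refine ((hR.fg.map _).map _).sup ?_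
    exact Subalgebra.fg_def.2 ⟨_, Set.finite_singleton _, rfl⟩
  surjective_pointEval := surjective_pointEval_away fun _ hφ =>
    mem_range_pointEval_pullback hR.surjective_pointEval hC hUC hCU hφ

/-- Affine charts: open immersions into `S` of an affine algebraic set with coordinate
ring `A`. -/
structure IsAffineChart (S : FunctionSheaf k X) (A : Subalgebra k (Z → k)) (j : Z → X) : Prop
    extends (ofAlgebra A).IsOpenImmersion S j, IsCoordinateRing A

/-- Every point lies in the image of an affine chart. -/
def IsLocallyAffine (S : FunctionSheaf k X) : Prop :=
  ∀ x, ∃ (Z : Type u) (A : Subalgebra k (Z → k)) (j : Z → X), S.IsAffineChart A j ∧ x ∈ Set.range j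

theorem IsLocallyAffine.isLocallyRinged {S : FunctionSheaf k X} (hS : S.IsLocallyAffine) :
    S.IsLocallyRinged := by
  choose Z A j hj hx using hS
  exact IsOpenImmersion.isLocallyRinged_of_surjective (fun x => (hj x).toIsOpenImmersion)
    (fun x => isLocallyRinged_ofAlgebra (A x)) fun x => ⟨x, hx x⟩

theorem IsVariety.isLocallyAffine {S : FunctionSheaf k X} (hS : S.IsVariety) :
    S.IsLocallyAffine := by
  intro x
  obtain ⟨m, V, hV, hcover, hcharts⟩ := hS.exists_charts
  obtain ⟨i, hi⟩ := Set.mem_iUnion.1 (hcover ▸ Set.mem_univ x)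
  obtain ⟨n, U, ⟨O, C, hO, hC, hUOC⟩, e, he, he'⟩ := hcharts i
  let R : Subalgebra k ((Fin n → k) → k) := (MvPolynomial.aeval fun i x => x i).range
  let u₀ : U := e ⟨x, hi⟩
  obtain ⟨r, hr, hru, hrO⟩ := exists_ne_zero_subset_of_isOpen hO (hUOC.subset u₀.2).1
  let h : pullback (Subtype.val : U → Fin n → k) R := pullbackHom _ R ⟨r, hr⟩
  have hj : (ofAlgebra (away _ h)).IsOpenImmersion S _ :=
    (isOpenImmersion_val_restrict (hV i)).comp <|
      (isOpenImmersion_of_isMorphism e.symm he' he).comp <|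
        (isOpenImmersion_id_pullback R U).comp (isOpenImmersion_val_away _ h)
  have hA : IsCoordinateRing (away _ h) :=
    (isCoordinateRing_mvPolynomial n).away_pullback hC (fun y hy => (hUOC.subset hy).2)
      fun y hyC hry => hUOC.superset ⟨hrO hry, hyC⟩
  exact ⟨_, _, _, ⟨hj, hA⟩, ⟨u₀, hru⟩, congrArg Subtype.val (e.symm_apply_apply ⟨x, hi⟩)⟩

end AffineCharts

section Normality

variable {k : Type*} [Field k] {X Y Z : Type*} {S : FunctionSheaf k X} {T : FunctionSheaf k Y}

/-- The homomorphism of local rings induced by an open immersion. -/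
def IsOpenImmersion.stalkHom {j : Y → X} (hj : T.IsOpenImmersion S j) (y : Y) :
    S.stalk (j y) →+* T.stalk y where
  toFun γ := ⟨γ.1.compTendsto j (hj.map_nhds_eq y).le, by
    obtain ⟨γ, hγ⟩ := γ
    induction γ using Germ.inductionOn with
    | h g => exact hj.regularAt_comp_iff.2 hγ⟩
  map_one' := rfl
  map_zero' := rfl
  map_mul' := by
    rintro ⟨γ, hγ⟩ ⟨δ, hδ⟩
    induction γ, δ using Germ.inductionOn₂ with
    | _ => rfl
  map_add' := by
    rintro ⟨γ, hγ⟩ ⟨δ, hδ⟩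
    induction γ, δ using Germ.inductionOn₂ with
    | _ => rfl

theorem IsOpenImmersion.bijective_stalkHom {j : Y → X} (hj : T.IsOpenImmersion S j) (y : Y) :
    Function.Bijective (hj.stalkHom y) := by
  refine ⟨(injective_iff_map_eq_zero _).2 ?_, ?_⟩
  · rintro ⟨γ, hγ⟩ h
    induction γ using Germ.inductionOn with
    | h g =>
      have h0 : ∀ᶠ z in @nhds Y T.toTopologicalSpace y, g (j z) = 0 :=
        Germ.coe_eq.1 (congrArg Subtype.val h)
      have h0 : ∀ᶠ x in @nhds X S.toTopologicalSpace (j y), g x = 0 := by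
        rwa [← hj.map_nhds_eq]
      exact Subtype.ext (Germ.coe_eq.2 h0)
  · rintro ⟨γ, hγ⟩
    induction γ using Germ.inductionOn with
    | h g =>
      refine ⟨⟨(Function.extend j g 0 : X → k), hj.regularAt_extend_iff.2 hγ⟩, Subtype.ext ?_⟩
      exact Germ.coe_eq.2 (Eventually.of_forall (hj.injective.extend_apply g 0))

theorem IsNormal.of_isOpenImmersion {j : Y → X} (hS : S.IsNormal) (hj : T.IsOpenImmersion S j) :
    T.IsNormal := by
  intro y
  obtain ⟨_, _⟩ := hS (j y)
  let e := RingEquiv.ofBijective _ (hj.bijective_stalkHom y)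
  exact ⟨e.symm.toMulEquiv.isDomain _, .of_equiv e⟩

variable {A : Subalgebra k (Z → k)}

/-- The homomorphism from an algebra of functions to its local ring at a point. -/
def toStalk (A : Subalgebra k (Z → k)) (z : Z) : A →+* (ofAlgebra A).stalk z where
  toFun a := ⟨(a.1 : Germ _ k), regularAt_of_mem a.2 z⟩
  map_one' := rfl
  map_zero' := rfl
  map_mul' _ _ := rfl
  map_add' _ _ := rfl

instance isPrime_ker_pointEval (A : Subalgebra k (Z → k)) (z : Z) :
    (RingHom.ker (pointEval A z)).IsPrime :=
  RingHom.ker_isPrime _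

theorem isLocalization_stalk (A : Subalgebra k (Z → k)) (z : Z) :
    let := (toStalk A z).toAlgebra
    IsLocalization.AtPrime ((ofAlgebra A).stalk z) (RingHom.ker (pointEval A z)) := by
  let := (toStalk A z).toAlgebra
  let := algebraTopology A
  refine ⟨fun ⟨d, hd⟩ => ?_, fun ⟨γ, hγ⟩ => ?_, fun {a b} hab => ?_⟩
  · have hA := isLocallyRinged_ofAlgebra A
    have hdr := regularAt_of_mem d.2 z
    refine .of_mul_eq_one ⟨(d.1⁻¹ : Z → k), hA.inv hdr hd⟩ (Subtype.ext (Germ.coe_eq.2 ?_))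
    filter_upwards [hA.eventually_ne_zero hdr hd] with y hy
    exact mul_inv_cancel₀ hy
  · induction γ using Germ.inductionOn with
    | h g =>
      obtain ⟨n, hn, d, hd, hdz, h⟩ := regularAt_ofAlgebra_iff.1 hγ
      refine ⟨(⟨n, hn⟩, ⟨⟨d, hd⟩, hdz⟩), Subtype.ext (Germ.coe_eq.2 ?_)⟩
      exact Eventually.of_forall fun y => (mul_comm _ _).trans (h y)
  · have hab : ∀ᶠ y in 𝓝 z, a.1 y = b.1 y := Germ.coe_eq.1 (congrArg Subtype.val hab)
    obtain ⟨O, hO, hOo, hzO⟩ := eventually_nhds_iff.1 hab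
    obtain ⟨s, hs, hsz, hsO⟩ := exists_ne_zero_subset_of_isOpen hOo hzO
    refine ⟨⟨⟨s, hs⟩, hsz⟩, Subtype.ext (funext fun y => ?_)⟩
    by_cases hsy : s y = 0
    · simp [hsy]
    · exact congrArg (s y * ·) (hO y (hsO hsy))

theorem IsCoordinateRing.isIntegrallyClosed [IsAlgClosed k] [IsDomain A]
    (hA : IsCoordinateRing A) (hN : (ofAlgebra A).IsNormal) : IsIntegrallyClosed A := by
  have := A.fg_iff_finiteType.1 hA.fg
  refine .of_localization_maximal fun m _ hm => ?_
  obtain ⟨φ, hmφ, -⟩ := exists_algHom_le_ker_and_apply_ne_zero (k := k) hm.isPrime.isRadical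
    ((Ideal.ne_top_iff_one m).1 hm.ne_top)
  obtain ⟨z, rfl⟩ := hA.surjective_pointEval φ
  obtain rfl := hm.eq_of_le (RingHom.ker_ne_top _) hmφ
  let := (toStalk A z).toAlgebra
  have := isLocalization_stalk A z
  have := (hN z).2
  exact .of_equiv (IsLocalization.algEquiv (RingHom.ker (pointEval A z)).primeCompl
    ((ofAlgebra A).stalk z) _).toRingEquiv

end Normality

section Products

variable {k : Type*} [Field k] {X Y Z W : Type*} {S : FunctionSheaf k X} {T : FunctionSheaf k Y}
  {R : FunctionSheaf k Z}

theorem isMorphism_id : S.IsMorphism S id :=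
  ⟨@continuous_id X S.toTopologicalSpace, fun _ _ => id⟩

theorem isMorphism_const (x : X) : T.IsMorphism S fun _ => x :=
  ⟨@continuous_const Y X T.toTopologicalSpace S.toTopologicalSpace x,
    fun y g _ => T.const_mem_stalk (g x) y⟩

theorem IsMorphism.comp {c : Y → X} {c' : Z → Y} (hc : T.IsMorphism S c)
    (hc' : R.IsMorphism T c') : R.IsMorphism S (c ∘ c') :=
  ⟨@Continuous.comp Z Y X R.toTopologicalSpace T.toTopologicalSpace S.toTopologicalSpace _ _
    hc.1 hc'.1, fun z _ hg => hc'.2 z _ (hc.2 (c' z) _ hg)⟩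

theorem IsOpenImmersion.isMorphism {j : Y → X} (hj : T.IsOpenImmersion S j) : T.IsMorphism S j :=
  let := S.toTopologicalSpace
  let := T.toTopologicalSpace
  ⟨hj.isOpenEmbedding.continuous, fun _ _ => hj.regularAt_comp_iff.2⟩

theorem isOpenImmersion_id : S.IsOpenImmersion S id :=
  ⟨@IsOpenEmbedding.id X S.toTopologicalSpace, Iff.rfl⟩

theorem IsLocallyRinged.isMorphism_ofAlgebra_iff (hR : R.IsLocallyRinged)
    {A : Subalgebra k (X → k)} {c : Z → X} :
    R.IsMorphism (ofAlgebra A) c ↔ ∀ a ∈ A, ∀ z, R.RegularAt (a ∘ c) z := by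
  let := R.toTopologicalSpace
  let := algebraTopology A
  refine ⟨fun hc a ha z => hc.2 z a (regularAt_of_mem ha _), fun hc => ⟨?_, fun z g hg => ?_⟩⟩
  · refine continuous_generateFrom_iff.2 ?_
    rintro _ ⟨d, hd, rfl⟩
    exact isOpen_iff_mem_nhds.2 fun z hz => hR.eventually_ne_zero (hc d hd z) hz
  · obtain ⟨n, hn, d, hd, hdz, h⟩ := regularAt_ofAlgebra_iff.1 hg
    exact hR.regularAt_of_mul_eq (hc n hn z) (hc d hd z) hdz
      (Eventually.of_forall fun z' => h (c z'))

theorem IsMorphism.regularAt_of_mem_tensorOn {c : Z → X} {c' : Z → Y} (hc : R.IsMorphism S c)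
    (hc' : R.IsMorphism T c') {V : Set X} {V' : Set Y} {F : X × Y → k}
    (hF : F ∈ S.tensorOn T V V') {z : Z} (hz : c z ∈ V) (hz' : c' z ∈ V') :
    R.RegularAt (fun z => F (c z, c' z)) z := by
  suffices S.tensorOn T V V' ≤ (regularSubalgebra R z).comap (precomp k fun z => (c z, c' z)) from
    this hF
  refine Algebra.adjoin_le ?_
  rintro _ (⟨g, hg, rfl⟩ | ⟨g, hg, rfl⟩)
  · exact hc.2 z g (hg _ hz)
  · exact hc'.2 z g (hg _ hz')

theorem IsMorphism.prodMk {c : Z → X} {c' : Z → Y} (hR : R.IsLocallyRinged)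
    (hc : R.IsMorphism S c) (hc' : R.IsMorphism T c') :
    R.IsMorphism (S.prod T) fun z => (c z, c' z) := by
  let := R.toTopologicalSpace
  let := S.toTopologicalSpace
  let := T.toTopologicalSpace
  let := S.prodTopology T
  have hcont : Continuous fun z => (c z, c' z) := by
    refine continuous_generateFrom_iff.2 ?_
    rintro _ ⟨V, V', hV, hV', F, hF, rfl⟩
    refine isOpen_iff_mem_nhds.2 fun z ⟨hz, hz', hFz⟩ => ?_
    exact inter_mem (hc.1.continuousAt.preimage_mem_nhds (hV.mem_nhds hz))
      (inter_mem (hc'.1.continuousAt.preimage_mem_nhds (hV'.mem_nhds hz'))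
        (hR.eventually_ne_zero (hc.regularAt_of_mem_tensorOn hc' hF hz hz') hFz))
  refine ⟨hcont, ?_⟩
  rintro z g ⟨n, hn, d, hd, hdz, hg⟩
  have hg : ∀ᶠ p in 𝓝 (c z, c' z), g p = n p / d p := Germ.coe_eq.1 hg
  have hdr := hc.regularAt_of_mem_tensorOn hc' hd rfl rfl
  refine hR.regularAt_of_mul_eq (hc.regularAt_of_mem_tensorOn hc' hn rfl rfl) hdr hdz ?_
  filter_upwards [hcont.continuousAt.eventually hg, hR.eventually_ne_zero hdr hdz] with z' h h0
  rw [Function.comp_apply, h, mul_div_cancel₀ _ h0]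

theorem regularAt_of_mem_tensorOn {V : Set X} {V' : Set Y} {F : X × Y → k}
    (hF : F ∈ S.tensorOn T V V') {p : X × Y} (hp : p.1 ∈ V) (hp' : p.2 ∈ V') :
    (S.prod T).RegularAt F p :=
  ⟨F, tensorOn_anti S T (Set.singleton_subset_iff.2 hp) (Set.singleton_subset_iff.2 hp') hF,
    1, one_mem _, one_ne_zero, Germ.coe_eq.2 (Eventually.of_forall fun q => by simp)⟩

theorem irreducibleSpace_of_continuous_slices [TopologicalSpace X] [TopologicalSpace Y]
    [IrreducibleSpace X] [IrreducibleSpace Y] {τ : TopologicalSpace (X × Y)}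
    (hfst : ∀ y, Continuous[_, τ] fun x : X => (x, y))
    (hsnd : ∀ x, Continuous[_, τ] fun y : Y => (x, y)) : IrreducibleSpace (X × Y) := by
  refine { isPreirreducible_univ := ?_, toNonempty := inferInstance }
  rintro O O' hO hO' ⟨⟨x, y⟩, -, hxy⟩ ⟨⟨x', y'⟩, -, hxy'⟩
  obtain ⟨a, ha, ha'⟩ := nonempty_preirreducible_inter (hO.preimage (hfst y))
    (hO'.preimage (hfst y')) ⟨x, hxy⟩ ⟨x', hxy'⟩
  obtain ⟨b, hb, hb'⟩ := nonempty_preirreducible_inter (hO.preimage (hsnd a))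
    (hO'.preimage (hsnd a)) ⟨y, ha⟩ ⟨y', ha'⟩
  exact ⟨(a, b), trivial, hb, hb'⟩

theorem irreducibleSpace_prod (hS : S.IsLocallyRinged) (hT : T.IsLocallyRinged)
    (hX : @IrreducibleSpace X S.toTopologicalSpace)
    (hY : @IrreducibleSpace Y T.toTopologicalSpace) :
    @IrreducibleSpace (X × Y) (S.prodTopology T) :=
  let := S.toTopologicalSpace
  let := T.toTopologicalSpace
  @irreducibleSpace_of_continuous_slices X Y _ _ hX hY _
    (fun y => (isMorphism_id.prodMk hS (isMorphism_const y)).1)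
    (fun x => ((isMorphism_const x).prodMk hT isMorphism_id).1)

/-- The coordinate ring of a product: the algebra of functions on `Z × W` generated by `A` and `B`,
considered as algebras of functions of the first and the second variable. -/
def tensor (A : Subalgebra k (Z → k)) (B : Subalgebra k (W → k)) : Subalgebra k (Z × W → k) :=
  pullback Prod.fst A ⊔ pullback Prod.snd B

variable {A : Subalgebra k (Z → k)} {B : Subalgebra k (W → k)} {i : Z → X} {j : W → Y}

theorem isMorphism_prodMap (hi : (ofAlgebra A).IsMorphism S i) (hj : (ofAlgebra B).IsMorphism T j) :
    (ofAlgebra (tensor A B)).IsMorphism (S.prod T) (Prod.map i j) := by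
  have hlr := isLocallyRinged_ofAlgebra (tensor A B)
  have hfst : (ofAlgebra (tensor A B)).IsMorphism (ofAlgebra A) Prod.fst :=
    hlr.isMorphism_ofAlgebra_iff.2 fun a ha => regularAt_of_mem
      (SetLike.le_def.1 le_sup_left (comp_mem_pullback _ ha))
  have hsnd : (ofAlgebra (tensor A B)).IsMorphism (ofAlgebra B) Prod.snd :=
    hlr.isMorphism_ofAlgebra_iff.2 fun b hb => regularAt_of_mem
      (SetLike.le_def.1 le_sup_right (comp_mem_pullback _ hb))
  exact (hi.comp hfst).prodMk hlr (hj.comp hsnd)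

theorem exists_mem_tensorOn_range (hi : (ofAlgebra A).IsOpenImmersion S i)
    (hj : (ofAlgebra B).IsOpenImmersion T j) {r : Z × W → k} (hr : r ∈ tensor A B) :
    ∃ F ∈ S.tensorOn T (Set.range i) (Set.range j), ∀ p, F (Prod.map i j p) = r p := by
  suffices tensor A B ≤ pullback (Prod.map i j) (S.tensorOn T (Set.range i) (Set.range j)) by
    obtain ⟨F, hF, rfl⟩ := this hr
    exact ⟨F, hF, fun _ => rfl⟩
  refine sup_le ?_ ?_
  · rintro _ ⟨a, ha, rfl⟩
    refine ⟨_, Algebra.subset_adjoin (Or.inl ⟨Function.extend i a 0, ?_, rfl⟩),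
      funext fun p => hi.injective.extend_apply a 0 p.1⟩
    rintro _ ⟨z, rfl⟩
    exact hi.regularAt_extend_iff.2 (regularAt_of_mem ha z)
  · rintro _ ⟨b, hb, rfl⟩
    refine ⟨_, Algebra.subset_adjoin (Or.inr ⟨Function.extend j b 0, ?_, rfl⟩),
      funext fun p => hj.injective.extend_apply b 0 p.2⟩
    rintro _ ⟨w, rfl⟩
    exact hj.regularAt_extend_iff.2 (regularAt_of_mem hb w)

theorem isOpenEmbedding_prodMap (hi : (ofAlgebra A).IsOpenImmersion S i)
    (hj : (ofAlgebra B).IsOpenImmersion T j) :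
    @IsOpenEmbedding _ _ (algebraTopology (tensor A B)) (S.prodTopology T) (Prod.map i j) := by
  let := algebraTopology (tensor A B)
  let := S.prodTopology T
  refine .of_continuous_injective_isOpenMap (isMorphism_prodMap hi.isMorphism hj.isMorphism).1
    (hi.injective.prodMap hj.injective)
    ((isTopologicalBasis_algebraTopology _).isOpenMap_iff.2 ?_)
  rintro _ ⟨r, hr, rfl⟩
  obtain ⟨F, hF, hFr⟩ := exists_mem_tensorOn_range hi hj hr
  refine TopologicalSpace.isOpen_generateFrom_of_mem
    ⟨_, _, hi.isOpen_range, hj.isOpen_range, F, hF, ?_⟩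
  ext p
  constructor
  · rintro ⟨q, hq, rfl⟩
    exact ⟨⟨q.1, rfl⟩, ⟨q.2, rfl⟩, (hFr q).trans_ne hq⟩
  · obtain ⟨x, y⟩ := p
    rintro ⟨⟨z, rfl⟩, ⟨w, rfl⟩, hFp⟩
    exact ⟨(z, w), (hFr (z, w)).symm.trans_ne hFp, rfl⟩

theorem IsOpenImmersion.prodMap (hi : (ofAlgebra A).IsOpenImmersion S i)
    (hj : (ofAlgebra B).IsOpenImmersion T j) :
    (ofAlgebra (tensor A B)).IsOpenImmersion (S.prod T) (Prod.map i j) where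
  isOpenEmbedding := isOpenEmbedding_prodMap hi hj
  regularAt_comp_iff {g p} := by
    refine ⟨fun hg => ?_, (isMorphism_prodMap hi.isMorphism hj.isMorphism).2 p g⟩
    obtain ⟨n, hn, d, hd, hdp, h⟩ := regularAt_ofAlgebra_iff.1 hg
    obtain ⟨N, hN, hNn⟩ := exists_mem_tensorOn_range hi hj hn
    obtain ⟨D, hD, hDd⟩ := exists_mem_tensorOn_range hi hj hd
    refine (isLocallyRinged_prod S T).regularAt_of_mul_eq
      (regularAt_of_mem_tensorOn hN ⟨_, rfl⟩ ⟨_, rfl⟩)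
      (regularAt_of_mem_tensorOn hD ⟨_, rfl⟩ ⟨_, rfl⟩) ((hDd p).trans_ne hdp) ?_
    let := algebraTopology (tensor A B)
    let := S.prodTopology T
    filter_upwards [(isOpenEmbedding_prodMap hi hj).isOpen_range.mem_nhds ⟨p, rfl⟩]
    rintro _ ⟨q, rfl⟩
    rw [hNn, hDd]
    exact h q

end Products

section AffineLine

open Polynomial

variable {k : Type*} [Field k] {X Y Z : Type*} {S : FunctionSheaf k X} {T : FunctionSheaf k Y}

theorem aeval_id_apply (q : k[X]) (t : k) : aeval (id : k → k) q t = q.eval t := by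
  rw [aeval_fn_apply, id, coe_aeval_eq_eval]

theorem regularAt_affineLine_iff {g : k → k} {b : k} : (affineLine k).RegularAt g b ↔
    ∃ n d : k[X], d.eval b ≠ 0 ∧ ∀ t, d.eval t * g t = n.eval t := by
  refine regularAt_ofAlgebra_iff.trans ⟨?_, ?_⟩
  · rintro ⟨_, ⟨n, rfl⟩, _, ⟨d, rfl⟩, hdb, h⟩
    simp only [AlgHom.toRingHom_eq_coe, RingHom.coe_coe, aeval_id_apply] at hdb h
    exact ⟨n, d, hdb, h⟩
  · rintro ⟨n, d, hdb, h⟩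
    simp only [← aeval_id_apply] at hdb h
    exact ⟨_, ⟨n, rfl⟩, _, ⟨d, rfl⟩, hdb, h⟩

theorem isLocallyRinged_affineLine : (affineLine k).IsLocallyRinged :=
  isLocallyRinged_ofAlgebra _

theorem irreducibleSpace_affineLine [Infinite k] :
    @IrreducibleSpace k (affineLine k).toTopologicalSpace := by
  have hinj : Function.Injective (aeval (id : k → k) : k[X] →ₐ[k] _) := fun p q hpq =>
    Polynomial.funext fun t => by rw [← aeval_id_apply, hpq, aeval_id_apply]
  have : IsDomain (aeval (id : k → k)).range :=
    (AlgEquiv.ofInjective _ hinj).symm.toMulEquiv.isDomain _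
  exact irreducibleSpace_of_isDomain (R := (aeval (id : k → k)).range)

theorem IsLocallyRinged.isMorphism_affineLine_iff (hS : S.IsLocallyRinged) {g : X → k} :
    S.IsMorphism (affineLine k) g ↔ ∀ x, S.RegularAt g x := by
  refine hS.isMorphism_ofAlgebra_iff.trans ⟨fun h => h id ⟨Polynomial.X, aeval_X id⟩, ?_⟩
  rintro hg _ ⟨q, rfl⟩ x
  have hq : aeval g q = aeval id q ∘ g := aeval_algHom_apply (precomp k g) id q
  have hadjoin : Algebra.adjoin k {g} ≤ regularSubalgebra S x :=
    Algebra.adjoin_le (Set.singleton_subset_iff.2 (hg x))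
  exact hq ▸ hadjoin (aeval_mem_adjoin_singleton k g)

theorem IsOpenImmersion.isLocallyRinged {j : Y → X} (hj : T.IsOpenImmersion S j)
    (hS : S.IsLocallyRinged) : T.IsLocallyRinged where
  eventually_ne_zero {g y} hg hgy := by
    have h := hS.eventually_ne_zero (hj.regularAt_extend_iff.2 hg)
      (by rwa [hj.injective.extend_apply])
    rw [← hj.map_nhds_eq, eventually_map] at h
    simpa only [hj.injective.extend_apply] using h
  inv {g y} hg hgy := by
    have h := hS.inv (hj.regularAt_extend_iff.2 hg) (by rwa [hj.injective.extend_apply])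
    rw [← hj.regularAt_comp_iff] at h
    convert h using 1
    ext y
    simp only [Pi.inv_apply, Function.comp_apply, hj.injective.extend_apply]

/-- The total function that extends a partial function by zero. -/
noncomputable def totalize (f : X →. k) (x : X) : k :=
  open Classical in (f x).getOrElse 0

theorem totalize_coe (f : X →. k) (x : f.Dom) : totalize f x = f.asSubtype x := by
  classical
  exact Part.getOrElse_of_dom _ x.2 _

theorem IsLocallyRinged.isRationalFunction_iff (hS : S.IsLocallyRinged) {f : X →. k} :
    S.IsRationalFunction f ↔ IsOpen[S.toTopologicalSpace] f.Dom ∧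
      @Dense X S.toTopologicalSpace f.Dom ∧ ∀ x ∈ f.Dom, S.RegularAt (totalize f) x := by
  refine and_congr_right fun hopen => and_congr_right fun _ => ?_
  have hf := isOpenImmersion_val_restrict hopen
  rw [(hf.isLocallyRinged hS).isMorphism_affineLine_iff, Subtype.forall]
  refine forall₂_congr fun x hx => ?_
  rw [← hf.regularAt_comp_iff (y := ⟨x, hx⟩), ← funext (totalize_coe f)]
  rfl

/-- Polynomials over an algebra of functions on `Z` as functions on `Z × k`. -/
noncomputable def polynomialFun (A : Subalgebra k (Z → k)) : A[X] →ₐ[k] (Z × k → k) :=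
  AlgHom.pi fun p => (aeval p.2).comp (mapAlgHom (pointEval A p.1))

variable {A : Subalgebra k (Z → k)}

theorem polynomialFun_apply (w : A[X]) (p : Z × k) :
    polynomialFun A w p = (w.map (pointEval A p.1 : A →+* k)).eval p.2 := by
  simp [polynomialFun]

theorem polynomialFun_apply_eq_eval (w : A[X]) (z : Z) (b : k) :
    polynomialFun A w (z, b) = (w.eval (algebraMap k A b)).1 z := by
  rw [polynomialFun_apply, eval_map, ← pointEval_apply, ← RingHom.coe_coe (pointEval A z),
    ← eval₂_at_apply, RingHom.coe_coe, AlgHom.commutes]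
  rfl

theorem tensor_affineLine (A : Subalgebra k (Z → k)) :
    tensor A (aeval (id : k → k)).range = (polynomialFun A).range := by
  refine le_antisymm (sup_le ?_ ?_) ?_
  · rintro _ ⟨a, ha, rfl⟩
    exact ⟨C ⟨a, ha⟩, funext fun p => by simp [polynomialFun_apply]⟩
  · rintro _ ⟨_, ⟨q, rfl⟩, rfl⟩
    refine ⟨q.map (algebraMap k A), funext fun p => ?_⟩
    have hid : (pointEval A p.1 : A →+* k).comp (algebraMap k A) = RingHom.id k :=
      (pointEval A p.1).comp_algebraMap
    refine (polynomialFun_apply _ _).trans ?_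
    rw [Polynomial.map_map, hid, Polynomial.map_id, ← aeval_id_apply]
    rfl
  · rintro _ ⟨w, rfl⟩
    induction w using Polynomial.induction_on' with
    | add v w hv hw => exact (map_add (polynomialFun A) v w) ▸ add_mem hv hw
    | monomial n a =>
      have hfst : a.1 ∘ Prod.fst ∈ tensor A (aeval (id : k → k)).range :=
        SetLike.le_def.1 le_sup_left (comp_mem_pullback _ a.2)
      have hsnd : id ∘ Prod.snd ∈ tensor A (aeval (id : k → k)).range :=
        SetLike.le_def.1 le_sup_right (comp_mem_pullback _ ⟨X, aeval_X id⟩)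
      convert mul_mem hfst (pow_mem hsnd n) using 1
      ext p
      simp [polynomialFun_apply]

end AffineLine

section SeparatelyRegular

open Polynomial

variable {k : Type*} [Field k] {X Z : Type*} {S : FunctionSheaf k X}

theorem IsMorphism.isOpen_preimage {T : FunctionSheaf k Z} {c : Z → X} (hc : T.IsMorphism S c)
    {O : Set X} (hO : IsOpen[S.toTopologicalSpace] O) : IsOpen[T.toTopologicalSpace] (c ⁻¹' O) :=
  @IsOpen.preimage _ _ T.toTopologicalSpace S.toTopologicalSpace _ hc.1 _ hO

theorem IsLocallyRinged.eq_of_eqOn (hS : S.IsLocallyRinged)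
    (hX : @IrreducibleSpace X S.toTopologicalSpace) {g g' : X → k} {x : X} {O V : Set X}
    (hg : S.RegularAt g x) (hg' : S.RegularAt g' x) (hO : IsOpen[S.toTopologicalSpace] O)
    (hx : x ∈ O) (hV : IsOpen[S.toTopologicalSpace] V) (hVne : V.Nonempty)
    (h : Set.EqOn g g' (O ∩ V)) : g x = g' x := by
  let := S.toTopologicalSpace
  by_contra hne
  obtain ⟨W, hW, hWo, hxW⟩ := eventually_nhds_iff.1
    (hS.eventually_ne_zero ((S.stalk x).sub_mem hg hg') (sub_ne_zero.2 hne))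
  obtain ⟨y, ⟨hyO, hyW⟩, hyV⟩ :=
    nonempty_preirreducible_inter (hO.inter hWo) hV ⟨x, hx, hxW⟩ hVne
  exact hW y hyW (sub_eq_zero.2 (h ⟨hyO, hyV⟩))

variable {A : Subalgebra k (Z → k)} {U : Set (Z × k)} {F G : Z × k → k} {P Q w : A[X]} {z : Z}
  {b : k}

theorem isMorphism_prodMk_left (b : k) :
    (ofAlgebra A).IsMorphism (ofAlgebra (polynomialFun A).range) fun z => (z, b) := by
  refine (isLocallyRinged_ofAlgebra A).isMorphism_ofAlgebra_iff.2 ?_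
  rintro _ ⟨w, rfl⟩ z
  convert regularAt_of_mem (w.eval (algebraMap k A b)).2 z using 1
  exact funext fun z => polynomialFun_apply_eq_eval w z b

theorem isMorphism_prodMk_right (z : Z) :
    (affineLine k).IsMorphism (ofAlgebra (polynomialFun A).range) fun b => (z, b) := by
  refine isLocallyRinged_affineLine.isMorphism_ofAlgebra_iff.2 ?_
  rintro _ ⟨w, rfl⟩ b
  refine regularAt_affineLine_iff.2 ⟨w.map (pointEval A z : A →+* k), 1, by simp, fun t => ?_⟩
  rw [eval_one, one_mul, ← polynomialFun_apply w (z, t)]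
  rfl

theorem isOpen_polynomialFun_ne_zero (w : A[X]) :
    IsOpen[algebraTopology (polynomialFun A).range] {p | polynomialFun A w p ≠ 0} :=
  isOpen_ne_zero (R := (polynomialFun A).range) ⟨w, rfl⟩

theorem regularAt_polynomialFun (w : A[X]) (p : Z × k) :
    (ofAlgebra (polynomialFun A).range).RegularAt (polynomialFun A w) p :=
  regularAt_of_mem (R := (polynomialFun A).range) ⟨w, rfl⟩ p

/-- The function `F` is regular in each of its two variables separately, at all points of `U`. -/
structure SeparatelyRegular (A : Subalgebra k (Z → k)) (U : Set (Z × k)) (F : Z × k → k) :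
    Prop where
  fst {z : Z} {b : k} (h : (z, b) ∈ U) : (ofAlgebra A).RegularAt (fun z => F (z, b)) z
  snd {z : Z} {b : k} (h : (z, b) ∈ U) : (affineLine k).RegularAt (fun b => F (z, b)) b

theorem separatelyRegular_polynomialFun (U : Set (Z × k)) (w : A[X]) :
    SeparatelyRegular A U (polynomialFun A w) where
  fst {z b} _ := (isMorphism_prodMk_left b).2 z _ (regularAt_polynomialFun w _)
  snd {z b} _ := (isMorphism_prodMk_right z).2 b _ (regularAt_polynomialFun w _)

theorem SeparatelyRegular.mul (hF : SeparatelyRegular A U F) (hG : SeparatelyRegular A U G) :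
    SeparatelyRegular A U (F * G) where
  fst h := ((ofAlgebra A).stalk _).mul_mem (hF.fst h) (hG.fst h)
  snd h := ((affineLine k).stalk _).mul_mem (hF.snd h) (hG.snd h)

theorem exists_ne_zero_subset_slice (hU : IsOpen[algebraTopology (polynomialFun A).range] U)
    (h : (z, b) ∈ U) : ∃ s : A, s ≠ 0 ∧ ∀ z', s.1 z' ≠ 0 → (z', b) ∈ U := by
  obtain ⟨s, hs, hsz, hsU⟩ := exists_ne_zero_subset_of_isOpen
    ((isMorphism_prodMk_left b).isOpen_preimage hU) h
  exact ⟨⟨s, hs⟩, fun h0 => hsz (congrFun (congrArg Subtype.val h0) z), fun z' hz' => hsU hz'⟩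

theorem infinite_slice [Infinite k] (hU : IsOpen[algebraTopology (polynomialFun A).range] U)
    (h : (z, b) ∈ U) : {b' | (z, b') ∈ U}.Infinite := by
  obtain ⟨_, ⟨w, rfl⟩, hw, hwU⟩ := exists_ne_zero_subset_of_isOpen hU h
  have hw0 : w.map (pointEval A z : A →+* k) ≠ 0 := fun h0 => hw <| by
    exact (polynomialFun_apply w _).trans (by rw [h0, eval_zero])
  refine (finite_setOfPred_isRoot hw0).infinite_compl.mono fun b' hb' => hwU ?_
  exact (polynomialFun_apply w (z, b')).trans_ne hb'

theorem SeparatelyRegular.eqOn [Infinite k] [IsDomain A]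
    (hU : IsOpen[algebraTopology (polynomialFun A).range] U) (hF : SeparatelyRegular A U F)
    (hG : SeparatelyRegular A U G) (hw : w ≠ 0)
    (h : Set.EqOn F G (U ∩ {p | polynomialFun A w p ≠ 0})) : Set.EqOn F G U := by
  have hvert {z : Z} (hz : w.leadingCoeff.1 z ≠ 0) {b : k} (hb : (z, b) ∈ U) :
      F (z, b) = G (z, b) := by
    have hwz : w.map (pointEval A z : A →+* k) ≠ 0 := fun h0 => hz <| by
      simpa using congrArg (coeff · w.natDegree) h0
    obtain ⟨b', hb'⟩ : ∃ b', polynomialFun A w (z, b') ≠ 0 := by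
      by_contra! hzero
      exact hwz (Polynomial.funext fun b' => by
        rw [← polynomialFun_apply w (z, b'), hzero, eval_zero])
    exact isLocallyRinged_affineLine.eq_of_eqOn irreducibleSpace_affineLine (hF.snd hb) (hG.snd hb)
      ((isMorphism_prodMk_right z).isOpen_preimage hU) hb
      ((isMorphism_prodMk_right z).isOpen_preimage (isOpen_polynomialFun_ne_zero w)) ⟨b', hb'⟩
      fun _ ht => h ht
  rintro ⟨z, b⟩ hb
  have : Nonempty Z := ⟨z⟩
  obtain ⟨z', hz'⟩ := Function.ne_iff.1 fun h0 => leadingCoeff_ne_zero.2 hw (Subtype.ext h0)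
  exact (isLocallyRinged_ofAlgebra A).eq_of_eqOn (irreducibleSpace_of_isDomain (R := A))
    (hF.fst hb) (hG.fst hb) ((isMorphism_prodMk_left b).isOpen_preimage hU) hb
    (isOpen_ne_zero w.leadingCoeff.2) ⟨z', hz'⟩ fun _ hz => hvert hz.2 hz.1

theorem IsCoordinateRing.exists_forall_ne_zero [IsAlgClosed k] [Uncountable k] [IsDomain A]
    (hA : IsCoordinateRing A) {ι : Type*} [Countable ι] (g : ι → A) (hg : ∀ i, g i ≠ 0) :
    ∃ z, ∀ i, (g i).1 z ≠ 0 := by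
  have : Algebra.FiniteType k A := A.fg_iff_finiteType.1 hA.fg
  obtain ⟨φ, hφ⟩ := exists_algHom_forall_ne_zero (k := k) g hg
  obtain ⟨z, rfl⟩ := hA.surjective_pointEval φ
  exact ⟨z, hφ⟩

theorem SeparatelyRegular.exists_det_eq_zero [IsAlgClosed k] [Uncountable k] [IsDomain A]
    (hA : IsCoordinateRing A) (hF : SeparatelyRegular A U F) {E : Type*} {b : E → k}
    {s n d : E → A} (hs : ∀ e, s e ≠ 0) (hsU : ∀ e z, (s e).1 z ≠ 0 → (z, b e) ∈ U)
    (hnd : ∀ e z, (d e).1 z * F (z, b e) = (n e).1 z) :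
    ∃ N, ∀ e : Fin N ⊕ Fin N → E,
      (Matrix.of fun i => interpolationRow N (n (e i)) (d (e i)) (algebraMap k A (b (e i)))).det
        = 0 := by
  by_contra! hdet
  choose e he using hdet
  obtain ⟨z, hz⟩ := hA.exists_forall_ne_zero
    (fun N => Matrix.det (.of fun i =>
      interpolationRow N (n (e N i)) (d (e N i)) (algebraMap k A (b (e N i)))) * ∏ i, s (e N i))
    fun N => mul_ne_zero (he N) (Finset.prod_ne_zero_iff.2 fun i _ => hs _)
  simp only [← pointEval_apply, map_mul, map_prod, mul_ne_zero_iff, Finset.prod_ne_zero_iff] at hz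
  have hzU (N i) : (z, b (e N i)) ∈ U := hsU _ z ((hz N).2 i (Finset.mem_univ i))
  obtain ⟨p, q, hq, hpq⟩ := regularAt_affineLine_iff.1 (hF.snd (hzU 1 (Sum.inl 0)))
  let N := max p.natDegree q.natDegree + 1
  refine (hz N).1 ?_
  have hrow (i) := map_comp_interpolationRow (pointEval A z : A →+* k) N (n (e N i)) (d (e N i))
    (algebraMap k A (b (e N i)))
  have hmap : (pointEval A z).mapMatrix (.of fun i =>
      interpolationRow N (n (e N i)) (d (e N i)) (algebraMap k A (b (e N i)))) =
      .of fun i => interpolationRow N ((n (e N i)).1 z) ((d (e N i)).1 z) (b (e N i)) :=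
    Matrix.ext fun i j => congrFun (hrow i) j
  rw [AlgHom.map_det, hmap]
  refine det_interpolationRow_eq_zero (Nat.lt_succ_of_le (le_max_left _ _))
    (Nat.lt_succ_of_le (le_max_right _ _)) (fun h0 => hq (by rw [h0, eval_zero])) fun i => ?_
  rw [← hnd, ← hpq]
  ring

theorem SeparatelyRegular.exists_mul_eq [IsAlgClosed k] [Uncountable k] [IsDomain A]
    (hA : IsCoordinateRing A) (hU : IsOpen[algebraTopology (polynomialFun A).range] U)
    (hF : SeparatelyRegular A U F) (hne : U.Nonempty) :
    ∃ P Q : A[X], Q ≠ 0 ∧ Set.EqOn (polynomialFun A Q * F) (polynomialFun A P) U := by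
  obtain ⟨⟨z₀, b₀⟩, h₀⟩ := hne
  have : Nonempty Z := ⟨z₀⟩
  let E := {b : k // ∃ z, (z, b) ∈ U}
  have : Infinite E :=
    Set.infinite_coe_iff.2 ((infinite_slice hU h₀).mono fun b hb => ⟨z₀, hb⟩)
  have hfrac (e : E) : ∃ n d : A, d ≠ 0 ∧ ∀ z, d.1 z * F (z, e.1) = n.1 z := by
    obtain ⟨b, z, hzb⟩ := e
    obtain ⟨n, hn, d, hd, hdz, h⟩ := regularAt_ofAlgebra_iff.1 (hF.fst hzb)
    exact ⟨⟨n, hn⟩, ⟨d, hd⟩, fun h0 => hdz (congrFun (congrArg Subtype.val h0) z), h⟩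
  choose n d hd hnd using hfrac
  choose s hs hsU using fun e : E => exists_ne_zero_subset_slice hU e.2.choose_spec
  obtain ⟨N, hN⟩ := hF.exists_det_eq_zero hA (b := Subtype.val) hs hsU hnd
  have hinj : Function.Injective fun e : E => algebraMap k A e.1 :=
    (algebraMap k A).injective.comp Subtype.val_injective
  obtain ⟨P, Q, hQ, hPQ⟩ := exists_interpolant hinj hd N hN
  refine ⟨P, Q, hQ, fun ⟨z, b⟩ hzb => ?_⟩
  let e : E := ⟨b, z, hzb⟩
  obtain ⟨z', hz'⟩ := Function.ne_iff.1 fun h0 => hd e (Subtype.ext h0)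
  have hQF := (separatelyRegular_polynomialFun U Q).mul hF
  refine (isLocallyRinged_ofAlgebra A).eq_of_eqOn (irreducibleSpace_of_isDomain (R := A))
    (hQF.fst hzb) ((separatelyRegular_polynomialFun U P).fst hzb)
    (@isOpen_univ Z (algebraTopology A)) trivial (isOpen_ne_zero (d e).2) ⟨z', hz'⟩ ?_
  rintro y ⟨-, hy⟩
  refine mul_left_cancel₀ hy ?_
  have hPQy := congrArg (pointEval A y) (hPQ e)
  simp only [map_mul, pointEval_apply] at hPQy
  simp only [Pi.mul_apply, polynomialFun_apply_eq_eval]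
  rw [hPQy, ← hnd]
  ring

theorem SeparatelyRegular.eqOn_of_mul_eq [Infinite k] [IsDomain A]
    (hU : IsOpen[algebraTopology (polynomialFun A).range] U) (hF : SeparatelyRegular A U F)
    (hQ : Q ≠ 0) (hPQ : Set.EqOn (polynomialFun A Q * F) (polynomialFun A P) U) {d n : A[X]}
    (h : d * P = n * Q) : Set.EqOn (polynomialFun A d * F) (polynomialFun A n) U := by
  refine ((separatelyRegular_polynomialFun U d).mul hF).eqOn hU
    (separatelyRegular_polynomialFun U n) hQ fun p ⟨hpU, hp⟩ => mul_right_cancel₀ hp ?_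
  rw [← Pi.mul_apply (polynomialFun A n), ← map_mul, ← h, map_mul, Pi.mul_apply, Pi.mul_apply,
    ← hPQ hpU, Pi.mul_apply]
  ring

theorem IsCoordinateRing.exists_eq_polynomialFun (hA : IsCoordinateRing A) (φ : A[X] →ₐ[k] k) :
    ∃ p, ∀ w, φ w = polynomialFun A w p := by
  obtain ⟨z, hz⟩ := hA.surjective_pointEval (φ.comp CAlgHom)
  suffices φ = (Pi.evalAlgHom k (fun _ => k) (z, φ Polynomial.X)).comp (polynomialFun A) from
    ⟨_, fun w => congrArg (· w) this⟩
  refine algHom_ext' (hz.symm.trans ?_) ?_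
  · ext a
    simp [polynomialFun_apply]
  · simp [polynomialFun_apply]

theorem SeparatelyRegular.exists_mul_eq_mul_ne_zero [IsAlgClosed k] [IsDomain A]
    [IsIntegrallyClosed A] (hA : IsCoordinateRing A)
    (hU : IsOpen[algebraTopology (polynomialFun A).range] U) (hF : SeparatelyRegular A U F)
    (hQ : Q ≠ 0) (hPQ : Set.EqOn (polynomialFun A Q * F) (polynomialFun A P) U) {p : Z × k}
    (hp : p ∈ U) : ∃ d n, d * P = n * Q ∧ polynomialFun A d p ≠ 0 := by
  have : Algebra.FiniteType k A := A.fg_iff_finiteType.1 hA.fg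
  have : IsNoetherianRing A := Algebra.FiniteType.isNoetherianRing k A
  let m : Ideal A[X] := RingHom.ker ((Pi.evalAlgHom k (fun _ => k) p).comp (polynomialFun A))
  have : m.IsPrime := RingHom.ker_isPrime _
  refine (exists_mul_eq_mul_notMem_or_exists_isPrime hQ P m).elim
    (fun ⟨d, hd, n, h⟩ => ⟨d, n, h, hd⟩) fun ⟨J, hJ, hJm, r, hr, u, hu, h, hru⟩ => ?_
  obtain ⟨_, ⟨w, rfl⟩, hwp, hwU⟩ := exists_ne_zero_subset_of_isOpen hU hp
  obtain ⟨φ, hφ, hφuw⟩ := exists_algHom_le_ker_and_apply_ne_zero (k := k) hJ.isRadical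
    (hJ.mul_notMem hu fun hw => hwp (hJm hw))
  obtain ⟨q, hq⟩ := hA.exists_eq_polynomialFun φ
  rw [map_mul, hq, hq] at hφuw
  have hruq := hF.eqOn_of_mul_eq hU hQ hPQ hru (hwU (right_ne_zero_of_mul hφuw))
  rw [Pi.mul_apply, map_mul, Pi.mul_apply, ← hq r, hφ hr, zero_mul, zero_mul] at hruq
  exact absurd hruq.symm (left_ne_zero_of_mul hφuw)

theorem SeparatelyRegular.regularAt [IsAlgClosed k] [Uncountable k] [IsDomain A]
    [IsIntegrallyClosed A] (hA : IsCoordinateRing A)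
    (hU : IsOpen[algebraTopology (polynomialFun A).range] U) (hF : SeparatelyRegular A U F)
    {p : Z × k} (hp : p ∈ U) : (ofAlgebra (polynomialFun A).range).RegularAt F p := by
  obtain ⟨P, Q, hQ, hPQ⟩ := hF.exists_mul_eq hA hU ⟨p, hp⟩
  obtain ⟨d, n, hdn, hdp⟩ := hF.exists_mul_eq_mul_ne_zero hA hU hQ hPQ hp
  exact (isLocallyRinged_ofAlgebra _).regularAt_of_mul_eq (regularAt_polynomialFun n p)
    (regularAt_polynomialFun d p) hdp (mem_of_superset
      (@IsOpen.mem_nhds _ (algebraTopology (polynomialFun A).range) _ _ hU hp)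
      (hF.eqOn_of_mul_eq hU hQ hPQ hdn))

end SeparatelyRegular

theorem IsAffineChart.regularAt_prod {k : Type*} [Field k] [IsAlgClosed k] [Uncountable k]
    {X Z : Type*} {S : FunctionSheaf k X} {A : Subalgebra k (Z → k)} {j : Z → X}
    (hj : S.IsAffineChart A j)
    (hX : @IrreducibleSpace X S.toTopologicalSpace) (hN : S.IsNormal) {U : Set (X × k)}
    (hU : IsOpen[(S.prod (affineLine k)).toTopologicalSpace] U) {F : X × k → k}
    (hfst : ∀ x b, (x, b) ∈ U → S.RegularAt (fun x => F (x, b)) x)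
    (hsnd : ∀ x b, (x, b) ∈ U → (affineLine k).RegularAt (fun b => F (x, b)) b) {z : Z} {b : k}
    (hzb : (j z, b) ∈ U) : (S.prod (affineLine k)).RegularAt F (j z, b) := by
  have : Nonempty Z := ⟨z⟩
  have : IsDomain A := isDomain_of_irreducibleSpace (hj.irreducibleSpace hX)
  have : IsIntegrallyClosed A :=
    hj.toIsCoordinateRing.isIntegrallyClosed (hN.of_isOpenImmersion hj.toIsOpenImmersion)
  have hprod : (ofAlgebra (polynomialFun A).range).IsOpenImmersion (S.prod (affineLine k))
      (Prod.map j id) :=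
    tensor_affineLine A ▸ hj.toIsOpenImmersion.prodMap isOpenImmersion_id
  have hsep : SeparatelyRegular A (Prod.map j id ⁻¹' U) (F ∘ Prod.map j id) :=
    ⟨fun h => hj.regularAt_comp_iff.2 (hfst _ _ h), fun h => hsnd _ _ h⟩
  have hpre := hprod.isMorphism.isOpen_preimage hU
  exact (hprod.regularAt_comp_iff (y := (z, b))).1 (hsep.regularAt hj.toIsCoordinateRing hpre hzb)

end FunctionSheaf

theorem theorem4p6_general {k : Type*} [Field k] [IsAlgClosed k] [Uncountable k] {X : Type*}
    (S : FunctionSheaf k X) (hS : S.IsLocallyAffine)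
    (hX : @IrreducibleSpace X S.toTopologicalSpace) (hN : S.IsNormal) (f : X × k →. k)
    (hopen : IsOpen[(S.prod (FunctionSheaf.affineLine k)).toTopologicalSpace] f.Dom)
    (hne : f.Dom.Nonempty)
    (hslice : ∀ (a : X) (b : k), (a, b) ∈ f.Dom →
      (FunctionSheaf.affineLine k).IsRationalFunction (f.sliceFst a) ∧
        S.IsRationalFunction (f.sliceSnd b)) :
    (S.prod (FunctionSheaf.affineLine k)).IsRationalFunction f := by
  have hlr := hS.isLocallyRinged
  have hline := FunctionSheaf.isLocallyRinged_affineLine (k := k)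
  have hirr := FunctionSheaf.irreducibleSpace_prod hlr hline hX
    FunctionSheaf.irreducibleSpace_affineLine
  refine (FunctionSheaf.isLocallyRinged_prod _ _).isRationalFunction_iff.2 ⟨hopen,
    @IsOpen.dense _ (S.prodTopology _) _ hirr.toPreirreducibleSpace hopen hne, ?_⟩
  rintro ⟨x, b⟩ hxb
  obtain ⟨Z, A, j, hj, z, rfl⟩ := hS x
  exact hj.regularAt_prod hX hN hopen
    (fun a b hab => (hlr.isRationalFunction_iff.1 (hslice a b hab).2).2.2 a hab)
    (fun a b hab => (hline.isRationalFunction_iff.1 (hslice a b hab).1).2.2 b hab) hxb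

theorem theorem4p6 {k : Type*} [Field k] [IsAlgClosed k]
    (hk : Cardinal.continuum < Cardinal.mk k)
    {X : Type*} (S : FunctionSheaf k X) (hX : S.IsVariety) (hN : S.IsNormal)
    (f : X × k →. k)
    (hopen : IsOpen[(S.prod (FunctionSheaf.affineLine k)).toTopologicalSpace] f.Dom)
    (hne : f.Dom.Nonempty)
    (hslice : ∀ (a : X) (b : k), (a, b) ∈ f.Dom →
      (FunctionSheaf.affineLine k).IsRationalFunction (f.sliceFst a) ∧
        S.IsRationalFunction (f.sliceSnd b)) :
    (S.prod (FunctionSheaf.affineLine k)).IsRationalFunction f :=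
  have : Uncountable k := Cardinal.aleph0_lt_mk_iff.1 (Cardinal.aleph0_lt_continuum.trans hk)
  theorem4p6_general S hX.isLocallyAffine hX.irreducible hN f hopen hne hslice
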